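/- Let $k$ be a commutative ring and $R$ a (not necessarily commutative) $k$-algebra. Write $\bar R=R^{\mathrm{op}}$, with elements $\bar r$ for $r\in R$, and $R^e=R\otimes_k\bar R$, so that left $R^e$-modules are $R$-bimodules (with central action of $k$), $r m r'=r\bar r' m$; for $R^e$-modules $M,N$ let $M\otimes_R N$ be the tensor product with $\bar r m\otimes n=m\otimes rn$, with $r(m\otimes n)=rm\otimes n$ and $\bar r(m\otimes n)=m\otimes\bar r n$. A $\times_R$-bialgebra is a $k$-algebra $H$ with an algebra homomorphism $R^e\to H$ and $R^e$-linear maps $\Delta\colon H\to H\otimes_R H$, $\Delta(h)=\sum h_{1}\otimes h_{2}$, and $\varepsilon\colon H\to R$ such that $\Delta$ is coassociative with counit $\varepsilon$ (that is, $\sum\varepsilon(h_1)h_2=h=\sum\overline{\varepsilon(h_2)}h_1$), $\Delta$ takes values in the Takeuchi product $\{\sum a_i\otimes b_i : \sum a_i\bar r\otimes b_i=\sum a_i\otimes b_i r\ \text{for all } r\in R\}$, $\Delta$ is multiplicative and unital, $\varepsilon(1)=1$, and $\varepsilon(gh)=\varepsilon(g\,\varepsilon(h))$. Equivalently, the category of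 left $H$-modules is monoidal, with tensor product $M\otimes_R N$ and action $h(m\otimes n)=\sum h_1m\otimes h_2n$, in such a way that the underlying functor ${}_H\mathcal M\to{}_{R^e}\mathcal M$ is strict monoidal. A right (left) inner hom-functor $\hom_r(M,-)$ ($\hom_l(M,-)$) in a monoidal category is a right adjoint of $-\otimes M$ (of $M\otimes -$); a monoidal functor $F$ preserves them if the morphism $F\hom(M,N)\to\hom(FM,FN)$ induced by evaluation is an isomorphism for all $M,N$. The $\times_R$-bialgebra $H$ is $\times_R$-Hopf if the underlying functor ${}_H\mathcal M\to{}_{R^e}\mathcal M$ preserves right inner hom-functors, and $\times_R$-anti-Hopf if it preserves left inner hom-functors (equivalently, if the coopposite of $H$ is $\times_{\bar R}$-Hopf). It is left finite if it is finitely generated projective as a left $\bar R$-module, and right finite if it is finitely generated projective as a left $R$-module. If $H$ is left finite, its left skew dual is $H^\vee=\operatorname{Hom}_{\bar R-}(H,R)$, the set of additive maps $\varphi\colon H\to R$ with $\varphi(\bar r h)=\varphi(h)r$, with the $\times_R$-bialgebra structure given by $$(\varphi\psi)(h)=\sum\varphi(\psi(h_1)h_2),\quad 1_{H^\vee}=\varepsilon,\quad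 (r\varphi)(h)=r\varphi(h),\quad (\bar r\varphi)(h)=\varphi(h\bar r),$$ $$\varphi(hg)=\sum\varphi_1\bigl(h\,\overline{\varphi_2(g)}\bigr),\quad \varepsilon_{H^\vee}(\varphi)=\varphi(1)$$ for $\varphi,\psi\in H^\vee$, $g,h\in H$, $r\in R$. **Theorem.** Let $H$ be a $\times_R$-bialgebra that is left finite and right finite, $\times_R$-Hopf and $\times_R$-anti-Hopf. Then the left skew dual $H^\vee$ is a $\times_R$-Hopf algebra. -/

import Mathlib

open scoped TensorProduct
open MulOpposite

universe u v

set_option linter.unusedSectionVars false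

namespace Takeuchi

/-! ### Tensor products over a noncommutative ring -/

section BTensor

variable (R : Type*) [Ring R]

/-- The relations `m r ⊗ n = m ⊗ r n` for a right `R`-module `M` (a module over `Rᵐᵒᵖ`) and a
left `R`-module `N`. -/
def balancing (M N : Type*) [AddCommGroup M] [AddCommGroup N] [Module Rᵐᵒᵖ M] [Module R N] :
    Submodule ℤ (M ⊗[ℤ] N) :=
  Submodule.span ℤ {x | ∃ (r : R) (m : M) (n : N), x = (op r • m) ⊗ₜ[ℤ] n - m ⊗ₜ[ℤ] (r • n)}

/-- The tensor product `M ⊗_R N` of a right `R`-module and a left `R`-module. -/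
def BTensor (M N : Type*) [AddCommGroup M] [AddCommGroup N] [Module Rᵐᵒᵖ M] [Module R N] :
    Type _ :=
  (M ⊗[ℤ] N) ⧸ balancing R M N

namespace BTensor

variable {M N P M' N' : Type*} [AddCommGroup M] [AddCommGroup N] [AddCommGroup P]
  [AddCommGroup M'] [AddCommGroup N'] [Module Rᵐᵒᵖ M] [Module R N] [Module Rᵐᵒᵖ M'] [Module R N']

instance : AddCommGroup (BTensor R M N) :=
  inferInstanceAs (AddCommGroup ((M ⊗[ℤ] N) ⧸ balancing R M N))

/-- The class of `m ⊗ n`. -/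
def tmul (m : M) (n : N) : BTensor R M N := Submodule.Quotient.mk (m ⊗ₜ[ℤ] n)

theorem add_tmul (m m' : M) (n : N) : tmul R (m + m') n = tmul R m n + tmul R m' n := by
  unfold tmul; rw [TensorProduct.add_tmul]; rfl

theorem tmul_add (m : M) (n n' : N) : tmul R m (n + n') = tmul R m n + tmul R m n' := by
  unfold tmul; rw [TensorProduct.tmul_add]; rfl

theorem smul_tmul (r : R) (m : M) (n : N) : tmul R (op r • m) n = tmul R m (r • n) := by
  refine (Submodule.Quotient.eq _).2 (Submodule.subset_span ⟨r, m, n, rfl⟩)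

/-- The additive map out of `M ⊗_R N` given by a balanced biadditive map. -/
def lift (f : M →+ N →+ P) (hf : ∀ (r : R) m n, f (op r • m) n = f m (r • n)) :
    BTensor R M N →+ P :=
  ((balancing R M N).liftQ
    (TensorProduct.liftAddHom f (fun z m n => by simp)).toIntLinearMap (by
      rw [balancing, Submodule.span_le]
      rintro _ ⟨r, m, n, rfl⟩
      simp [hf])).toAddMonoidHom

variable {R}

@[simp] theorem lift_tmul (f : M →+ N →+ P) (hf : ∀ (r : R) m n, f (op r • m) n = f m (r • n))
    (m : M) (n : N) : lift R f hf (tmul R m n) = f m n := by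
  simp only [lift, tmul]
  rfl

@[elab_as_elim]
theorem induction {motive : BTensor R M N → Prop} (x : BTensor R M N) (zero : motive 0)
    (tmul : ∀ m n, motive (tmul R m n)) (add : ∀ x y, motive x → motive y → motive (x + y)) :
    motive x := by
  obtain ⟨x, rfl⟩ := Submodule.Quotient.mk_surjective _ x
  induction x using TensorProduct.induction_on with
  | zero => exact zero
  | tmul m n => exact tmul m n
  | add x y hx hy => exact add _ _ hx hy

theorem exists_sum_tmul (x : BTensor R M N) :
    ∃ s : Finset (M × N), x = ∑ p ∈ s, tmul R p.1 p.2 := by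
  obtain ⟨x, rfl⟩ := Submodule.Quotient.mk_surjective _ x
  obtain ⟨s, rfl⟩ := TensorProduct.exists_finset x
  exact ⟨s, map_sum (balancing R M N).mkQ _ _⟩

theorem hom_ext {f g : BTensor R M N →+ P} (h : ∀ m n, f (tmul R m n) = g (tmul R m n)) :
    f = g := by
  ext x
  induction x using induction with
  | zero => simp
  | tmul m n => exact h m n
  | add x y hx hy => simp [hx, hy]

theorem hom_congr {f g : BTensor R M N →+ P} (h : ∀ m n, f (tmul R m n) = g (tmul R m n))
    (x : BTensor R M N) : f x = g x := by rw [hom_ext h]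

/-- The universal biadditive map. -/
def tmulHom (R : Type*) [Ring R] (M N : Type*) [AddCommGroup M] [AddCommGroup N]
    [Module Rᵐᵒᵖ M] [Module R N] : M →+ N →+ BTensor R M N :=
  AddMonoidHom.mk' (fun m => AddMonoidHom.mk' (fun n => tmul R m n) (tmul_add R m))
    (fun m m' => by ext n; exact add_tmul R m m' n)

@[simp] theorem tmulHom_apply (m : M) (n : N) : tmulHom R M N m n = tmul R m n := rfl

/-- Functoriality of the tensor product. -/
def map (f : M →ₗ[Rᵐᵒᵖ] M') (g : N →ₗ[R] N') : BTensor R M N →+ BTensor R M' N' :=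
  lift R (((tmulHom R M' N').comp f.toAddMonoidHom).compl₂ g.toAddMonoidHom)
    (fun r m n => by simp [smul_tmul])

@[simp] theorem map_tmul (f : M →ₗ[Rᵐᵒᵖ] M') (g : N →ₗ[R] N') (m : M) (n : N) :
    map f g (tmul R m n) = tmul R (f m) (g n) := by
  simp [map]

/-- If `M` is a bimodule, then `M ⊗_R N` is a left module: `r (m ⊗ n) = r m ⊗ n`. -/
instance [Module R M] [SMulCommClass R Rᵐᵒᵖ M] : Module R (BTensor R M N) where
  smul r := map (DistribSMul.toLinearMap Rᵐᵒᵖ M r) LinearMap.id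
  one_smul x := hom_congr (f := map _ _) (g := .id _) (fun m n => by simp) x
  mul_smul r r' x := hom_congr (f := map _ _) (g := (map _ _).comp (map _ _))
    (fun m n => by simp [mul_smul]) x
  smul_zero r := map_zero (map _ _)
  smul_add r := map_add (map _ _)
  add_smul r r' x := hom_congr (f := map _ _) (g := map _ _ + map _ _)
    (fun m n => by simp [add_smul, add_tmul]) x
  zero_smul x := hom_congr (f := map _ _) (g := 0)
    (fun m n => by simp; exact map_zero ((tmulHom R M N).flip n)) x

@[simp] theorem smul_tmul' [Module R M] [SMulCommClass R Rᵐᵒᵖ M] (r : R) (m : M) (n : N) :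
    r • tmul R m n = tmul R (r • m) n :=
  map_tmul (DistribSMul.toLinearMap Rᵐᵒᵖ M r) LinearMap.id m n

/-- If `N` is a bimodule, then `M ⊗_R N` is a right module: `(m ⊗ n) r = m ⊗ n r`. -/
instance [Module Rᵐᵒᵖ N] [SMulCommClass R Rᵐᵒᵖ N] : Module Rᵐᵒᵖ (BTensor R M N) :=
  haveI : SMulCommClass Rᵐᵒᵖ R N := SMulCommClass.symm _ _ _
  { smul := fun r => map LinearMap.id (DistribSMul.toLinearMap R N r)
    one_smul := fun x => hom_congr (f := map _ _) (g := .id _) (fun m n => by simp) x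
    mul_smul := fun r r' x => hom_congr (f := map _ _) (g := (map _ _).comp (map _ _))
      (fun m n => by simp [mul_smul]) x
    smul_zero := fun r => map_zero (map _ _)
    smul_add := fun r => map_add (map _ _)
    add_smul := fun r r' x => hom_congr (f := map _ _) (g := map _ _ + map _ _)
      (fun m n => by simp [add_smul, tmul_add]) x
    zero_smul := fun x => hom_congr (f := map _ _) (g := 0)
      (fun m n => by simp; exact map_zero (tmulHom R M N m)) x }

@[simp] theorem op_smul_tmul [Module Rᵐᵒᵖ N] [SMulCommClass R Rᵐᵒᵖ N] (a : Rᵐᵒᵖ) (m : M) (n : N) :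
    a • tmul R m n = tmul R m (a • n) :=
  haveI : SMulCommClass Rᵐᵒᵖ R N := SMulCommClass.symm _ _ _
  map_tmul LinearMap.id (DistribSMul.toLinearMap R N a) m n

section assoc

variable (M) [Module Rᵐᵒᵖ N] [SMulCommClass R Rᵐᵒᵖ N] [Module R P]

/-- The map `n ⊗ p ↦ (m ⊗ n) ⊗ p`. -/
def assocAux (m : M) : BTensor R N P →+ BTensor R (BTensor R M N) P :=
  lift R ((tmulHom R (BTensor R M N) P).comp (tmulHom R M N m))
    (fun r n p => by simp [← smul_tmul])

@[simp] theorem assocAux_tmul (m : M) (n : N) (p : P) :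
    assocAux M m (tmul R n p) = tmul R (tmul R m n) p :=
  lift_tmul _ _ n p

variable (N P)

/-- The associativity isomorphism `M ⊗_R (N ⊗_R P) → (M ⊗_R N) ⊗_R P`, as an additive map. -/
def assocInv : BTensor R M (BTensor R N P) →+ BTensor R (BTensor R M N) P :=
  lift R
    (AddMonoidHom.mk' (fun m => assocAux M m)
      (fun m m' => hom_ext (fun n p => by simp [add_tmul])))
    (fun r m x => hom_congr (f := assocAux M (op r • m))
        (g := (assocAux M m).comp (DistribSMul.toAddMonoidHom _ r))
        (fun n p => by simp [smul_tmul]) x)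

variable {M N P}

@[simp] theorem assocInv_tmul (m : M) (x : BTensor R N P) :
    assocInv M N P (tmul R m x) = assocAux M m x :=
  lift_tmul _ _ m x

end assoc

end BTensor

end BTensor

/-! ### `×_R`-bialgebras

An `R^e`-ring over the `k`-algebra `R`, that is, a `k`-algebra `H` with an algebra homomorphism
`R ⊗[k] Rᵐᵒᵖ → H`, is encoded by the resulting left module structures of `H` over `R` and over
`R̄ = Rᵐᵒᵖ`: the conditions `IsScalarTower R H H`, `IsScalarTower Rᵐᵒᵖ H H` and
`SMulCommClass R Rᵐᵒᵖ H` say exactly that `r ↦ r • 1` and `r̄ ↦ r̄ • 1` are ring homomorphisms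
`R → H`, `Rᵐᵒᵖ → H` with commuting images, which act by left multiplication, and
`IsScalarTower k R H`, `IsScalarTower k Rᵐᵒᵖ H` say that these are `k`-linear.
A left `H`-module `M` similarly carries the induced actions of `R` and `Rᵐᵒᵖ`
(`IsScalarTower R H M`, `IsScalarTower Rᵐᵒᵖ H M`), that is, its underlying `R^e`-module. -/

section Bialgebra

variable (R H : Type*) [Ring R] [Ring H] [Module R H] [Module Rᵐᵒᵖ H]

section act

variable {M N : Type*} [AddCommGroup M] [Module H M] [AddCommGroup N] [Module H N]
  [Module Rᵐᵒᵖ M] [IsScalarTower Rᵐᵒᵖ H M] [Module R N] [IsScalarTower R H N]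

variable {H} in
/-- The map `H ⊗_R H → M ⊗_R N`, `a ⊗ b ↦ a m ⊗ b n`. -/
def applyTo (m : M) (n : N) : BTensor R H H →+ BTensor R M N :=
  BTensor.map ((LinearMap.toSpanSingleton H M m).restrictScalars Rᵐᵒᵖ)
    ((LinearMap.toSpanSingleton H N n).restrictScalars R)

variable {R H} in
@[simp] theorem applyTo_tmul (m : M) (n : N) (a b : H) :
    applyTo R m n (BTensor.tmul R a b) = BTensor.tmul R (a • m) (b • n) :=
  BTensor.map_tmul _ _ a b

end act

variable [IsScalarTower R H H] [IsScalarTower Rᵐᵒᵖ H H]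

/-- The Takeuchi product `H ×_R H`: the elements `∑ aᵢ ⊗ bᵢ` of `H ⊗_R H` such that
`∑ aᵢ r̄ ⊗ bᵢ = ∑ aᵢ ⊗ bᵢ r` for all `r` in `R`. -/
def takeuchiProduct : AddSubgroup (BTensor R H H) where
  carrier := {x | ∀ r : R, applyTo R (op r • (1 : H)) (1 : H) x
    = applyTo R (1 : H) (r • (1 : H)) x}
  zero_mem' := fun r => by simp
  add_mem' := fun hx hy r => by simp [hx r, hy r]
  neg_mem' := fun hx r => by simp [hx r]

section diag

variable {R H} {M N : Type*} [AddCommGroup M] [Module H M] [AddCommGroup N] [Module H N]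
  [Module Rᵐᵒᵖ M] [IsScalarTower Rᵐᵒᵖ H M] [Module R N] [IsScalarTower R H N]

/-- The map `m ⊗ n ↦ ∑ aᵢ m ⊗ bᵢ n` of `M ⊗_R N` for an element `∑ aᵢ ⊗ bᵢ` of `H ×_R H`. -/
def takeuchiAct (x : takeuchiProduct R H) : BTensor R M N →+ BTensor R M N :=
  BTensor.lift R
    (AddMonoidHom.mk' (fun m => AddMonoidHom.mk' (fun n => applyTo R m n x.1)
        (fun n n' => BTensor.hom_congr (f := applyTo R m (n + n'))
          (g := applyTo R m n + applyTo R m n') (fun a b => by simp [BTensor.tmul_add]) x.1))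
      (fun m m' => by
        ext n
        exact BTensor.hom_congr (f := applyTo R (m + m') n)
          (g := applyTo R m n + applyTo R m' n) (fun a b => by simp [BTensor.add_tmul]) x.1))
    (fun r m n => by
      have h₁ := BTensor.hom_congr (f := applyTo R (op r • m) n)
        (g := (applyTo R m n).comp (applyTo R (op r • (1 : H)) (1 : H)))
        (fun a b => by simp [mul_smul]) x.1
      have h₂ := BTensor.hom_congr (f := applyTo R m (r • n))
        (g := (applyTo R m n).comp (applyTo R (1 : H) (r • (1 : H))))
        (fun a b => by simp [mul_smul]) x.1
      refine h₁.trans (Eq.trans ?_ h₂.symm)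
      exact congrArg (applyTo R m n) (x.2 r))

@[simp] theorem takeuchiAct_tmul (x : takeuchiProduct R H) (m : M) (n : N) :
    takeuchiAct x (BTensor.tmul R m n) = applyTo R m n x.1 :=
  BTensor.lift_tmul _ _ m n

end diag

variable [SMulCommClass R Rᵐᵒᵖ H]

/-- A `×_R`-bialgebra structure on the `R^e`-ring `H`. -/
class TakeuchiBialgebra where
  /-- The comultiplication `H → H ×_R H`. -/
  comul : H →+ takeuchiProduct R H
  /-- The counit `H → R`. -/
  counit : H →+ R
  comul_smul : ∀ (r : R) (h : H), (comul (r • h)).1 = r • (comul h).1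
  comul_op_smul : ∀ (r : R) (h : H), (comul (op r • h)).1 = op r • (comul h).1
  counit_smul : ∀ (r : R) (h : H), counit (r • h) = r * counit h
  counit_op_smul : ∀ (r : R) (h : H), counit (op r • h) = counit h * r
  /-- Coassociativity: `(Δ ⊗ H) Δ = (H ⊗ Δ) Δ`. -/
  coassoc : ∀ h : H,
    BTensor.map
        { toFun := fun a => (comul a).1
          map_add' := fun a b => by simp
          map_smul' := fun r a => comul_op_smul r.unop a } LinearMap.id (comul h).1
      = BTensor.assocInv H H H (BTensor.map LinearMap.id
        { toFun := fun a => (comul a).1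
          map_add' := fun a b => by simp
          map_smul' := fun r a => comul_smul r a } (comul h).1)
  /-- Left counit: `∑ ε(h₁) h₂ = h`. -/
  counit_left : ∀ h : H,
    BTensor.lift R
      ((AddMonoidHom.mk' (fun c : R => DistribSMul.toAddMonoidHom H c)
        (fun a b => by ext; simp [add_smul])).comp counit)
      (fun r a b => by simp [counit_op_smul, mul_smul]) (comul h).1 = h
  /-- Right counit: `∑ ε(h₂)‾ h₁ = h`. -/
  counit_right : ∀ h : H,
    BTensor.lift R
      ((AddMonoidHom.mk' (fun c : R => DistribSMul.toAddMonoidHom H (op c))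
        (fun a b => by ext; simp [add_smul])).comp counit).flip
      (fun r a b => by simp [counit_smul, mul_smul]) (comul h).1 = h
  comul_one : (comul 1).1 = BTensor.tmul R 1 1
  comul_mul : ∀ g h : H, (comul (g * h)).1 = takeuchiAct (comul g) (comul h).1
  counit_one : counit 1 = 1
  /-- The counit is multiplicative in the sense that `ε(g h) = ε(g ε(h))`. -/
  counit_mul : ∀ g h : H, counit (g * h) = counit (g * (counit h • (1 : H)))

end Bialgebra

/-! ### The left skew dual -/

section SkewDual

variable (R H : Type*) [Ring R] [Ring H] [Module R H] [Module Rᵐᵒᵖ H]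

/-- The underlying additive group `Hom_{R̄-}(H, R)` of the left skew dual: the maps `φ : H → R`
with `φ(r̄ h) = φ(h) r`. -/
def SkewDual : Type _ := H →ₗ[Rᵐᵒᵖ] R

namespace SkewDual

instance : AddCommGroup (SkewDual R H) := inferInstanceAs (AddCommGroup (H →ₗ[Rᵐᵒᵖ] R))

instance : FunLike (SkewDual R H) H R := inferInstanceAs (FunLike (H →ₗ[Rᵐᵒᵖ] R) H R)

instance : LinearMapClass (SkewDual R H) Rᵐᵒᵖ H R :=
  inferInstanceAs (LinearMapClass (H →ₗ[Rᵐᵒᵖ] R) Rᵐᵒᵖ H R)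

/-- The left `R`-module structure `(r φ)(h) = r φ(h)`. -/
instance : Module R (SkewDual R H) := inferInstanceAs (Module R (H →ₗ[Rᵐᵒᵖ] R))

variable {R H}

/-- Constructor from an additive map. -/
def mk (f : H →+ R) (hf : ∀ (r : R) h, f (op r • h) = f h * r) : SkewDual R H :=
  ({ f with map_smul' := fun a h => hf a.unop h } : H →ₗ[Rᵐᵒᵖ] R)

@[simp] theorem mk_apply (f : H →+ R) (hf : ∀ (r : R) h, f (op r • h) = f h * r) (h : H) :
    mk f hf h = f h := rfl

@[ext] theorem ext {φ ψ : SkewDual R H} (h : ∀ x, φ x = ψ x) : φ = ψ := DFunLike.ext _ _ h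

@[simp] theorem add_apply (φ ψ : SkewDual R H) (h : H) : (φ + ψ) h = φ h + ψ h := rfl
@[simp] theorem zero_apply (h : H) : (0 : SkewDual R H) h = 0 := rfl
@[simp] theorem smul_apply (r : R) (φ : SkewDual R H) (h : H) : (r • φ) h = r * φ h := rfl

theorem map_op_smul (φ : SkewDual R H) (r : R) (h : H) : φ (op r • h) = φ h * r :=
  map_smul φ (op r) h

/-- Evaluation as a biadditive map. -/
def evalHom (R H : Type*) [Ring R] [Ring H] [Module R H] [Module Rᵐᵒᵖ H] :
    SkewDual R H →+ H →+ R :=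
  AddMonoidHom.mk' (fun φ => (φ : H →+ R)) (fun _ _ => rfl)

@[simp] theorem evalHom_apply (φ : SkewDual R H) (h : H) : evalHom R H φ h = φ h := rfl

variable [IsScalarTower R H H] [IsScalarTower Rᵐᵒᵖ H H]

/-- The right translate `h ↦ φ(h g)`. -/
def translate (g : H) : SkewDual R H →+ SkewDual R H :=
  AddMonoidHom.mk' (fun φ => mk ((φ : H →+ R).comp (AddMonoidHom.mulRight g))
    (fun r h => by simp [smul_mul_assoc]))
    (fun _ _ => rfl)

@[simp] theorem translate_apply (φ : SkewDual R H) (g h : H) : translate g φ h = φ (h * g) := rfl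

/-- The right `R`-module structure `(φ r)(h) = φ(h r̄)`. -/
instance : Module Rᵐᵒᵖ (SkewDual R H) where
  smul a := translate (a • (1 : H))
  one_smul φ := ext fun h => by
    change φ (h * ((1 : Rᵐᵒᵖ) • (1 : H))) = φ h
    simp
  mul_smul a b φ := ext fun h => by
    change φ (h * ((a * b) • (1 : H))) = φ (h * (a • (1 : H)) * (b • (1 : H)))
    rw [mul_smul, mul_assoc, smul_mul_assoc, one_mul]
  smul_zero a := map_zero (translate _)
  smul_add a := map_add (translate _)
  add_smul a b φ := ext fun h => by
    change φ (h * ((a + b) • (1 : H))) = φ (h * (a • (1 : H))) + φ (h * (b • (1 : H)))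
    rw [add_smul, mul_add, map_add]
  zero_smul φ := ext fun h => by
    change φ (h * ((0 : Rᵐᵒᵖ) • (1 : H))) = 0
    rw [zero_smul, mul_zero, map_zero]

@[simp] theorem op_smul_apply (a : Rᵐᵒᵖ) (φ : SkewDual R H) (h : H) :
    (a • φ) h = φ (h * (a • (1 : H))) := rfl

instance : SMulCommClass R Rᵐᵒᵖ (SkewDual R H) := ⟨fun _ _ _ => rfl⟩

variable [SMulCommClass R Rᵐᵒᵖ H]

/-- The functional `a ⊗ b ↦ φ(ψ(a) b)` on `H ⊗_R H`. -/
def conv (φ ψ : SkewDual R H) : BTensor R H H →+ R :=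
  BTensor.lift R
    (AddMonoidHom.mk' (fun a => (φ : H →+ R).comp (DistribSMul.toAddMonoidHom H (ψ a)))
      (fun a b => by ext; simp [add_smul]))
    (fun r a b => by simp [mul_smul])

@[simp] theorem conv_tmul (φ ψ : SkewDual R H) (a b : H) :
    conv φ ψ (BTensor.tmul R a b) = φ (ψ a • b) := BTensor.lift_tmul _ _ a b

theorem conv_op_smul (φ ψ : SkewDual R H) (r : R) (x : BTensor R H H) :
    conv φ ψ (op r • x) = conv φ ψ x * r :=
  BTensor.hom_congr (f := (conv φ ψ).comp (DistribSMul.toAddMonoidHom _ (op r)))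
    (g := (AddMonoidHom.mulRight r).comp (conv φ ψ))
    (fun a b => by simp [smul_comm (ψ a) (op r) b]) x

variable [TakeuchiBialgebra R H]

open TakeuchiBialgebra

/-- The multiplication `(φ ψ)(h) = ∑ φ(ψ(h₁) h₂)`. -/
instance : Mul (SkewDual R H) where
  mul φ ψ := mk ((conv φ ψ).comp ((takeuchiProduct R H).subtype.comp comul))
    (fun r h => by simp [comul_op_smul, conv_op_smul])

theorem mul_apply (φ ψ : SkewDual R H) (h : H) : (φ * ψ) h = conv φ ψ (comul (R := R) h).1 := rfl

/-- The unit is the counit of `H`. -/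
instance : One (SkewDual R H) where
  one := mk counit counit_op_smul

theorem one_apply (h : H) : (1 : SkewDual R H) h = counit h := rfl

/-- The functional on `(H ⊗_R H) ⊗_R H` used for associativity. -/
def conv₃ (φ ψ χ : SkewDual R H) : BTensor R (BTensor R H H) H →+ R :=
  BTensor.lift R
    (AddMonoidHom.mk' (fun a => (φ : H →+ R).comp (DistribSMul.toAddMonoidHom H (conv ψ χ a)))
      (fun a b => by ext; simp [add_smul]))
    (fun r a b => by simp [conv_op_smul, mul_smul])

@[simp] theorem conv₃_tmul (φ ψ χ : SkewDual R H) (a : BTensor R H H) (b : H) :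
    conv₃ φ ψ χ (BTensor.tmul R a b) = φ (conv ψ χ a • b) := BTensor.lift_tmul _ _ a b

theorem conv_smul (φ ψ : SkewDual R H) (r : R) (x : BTensor R H H) :
    conv φ ψ (r • x) = conv φ (mk ((ψ : H →+ R).comp (DistribSMul.toAddMonoidHom H r))
      (fun s h => by simp [smul_comm r (op s) h])) x :=
  BTensor.hom_congr (f := (conv φ ψ).comp (DistribSMul.toAddMonoidHom _ r))
    (g := conv φ (mk _ _)) (fun a b => by simp) x

theorem mul_assoc' (φ ψ χ : SkewDual R H) : φ * ψ * χ = φ * (ψ * χ) := by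
  ext h
  have e := congrArg (conv₃ φ ψ χ) (coassoc (R := R) h)
  refine (Eq.trans ?_ e.symm).trans ?_
  · rw [mul_apply]
    refine BTensor.hom_congr (f := conv (φ * ψ) χ) (g := (conv₃ φ ψ χ).comp
      ((BTensor.assocInv H H H).comp (BTensor.map _ _))) (fun a b => ?_) _
    simp only [conv_tmul, mul_apply, AddMonoidHom.comp_apply, BTensor.map_tmul,
      BTensor.assocInv_tmul, LinearMap.id_apply, comul_smul]
    refine BTensor.hom_congr (f := (conv φ ψ).comp (DistribSMul.toAddMonoidHom _ (χ a)))
      (g := (conv₃ φ ψ χ).comp (BTensor.assocAux H a)) (fun c d => ?_) _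
    simp
  · rw [mul_apply]
    refine BTensor.hom_congr (f := (conv₃ φ ψ χ).comp (BTensor.map _ _)) (g := conv φ (ψ * χ))
      (fun a b => ?_) _
    simp only [AddMonoidHom.comp_apply, BTensor.map_tmul, conv₃_tmul, conv_tmul, mul_apply]
    rfl

theorem one_mul' (φ : SkewDual R H) : 1 * φ = φ := by
  ext h
  rw [mul_apply]
  conv_rhs => rw [← counit_right (R := R) h]
  refine BTensor.hom_congr (f := conv 1 φ) (g := (φ : H →+ R).comp (BTensor.lift R _ _))
    (fun a b => ?_) _
  simp [one_apply, counit_smul]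

theorem mul_one' (φ : SkewDual R H) : φ * 1 = φ := by
  ext h
  rw [mul_apply]
  conv_rhs => rw [← counit_left (R := R) h]
  refine BTensor.hom_congr (f := conv φ 1) (g := (φ : H →+ R).comp (BTensor.lift R _ _))
    (fun a b => ?_) _
  simp [one_apply]

instance : Ring (SkewDual R H) where
  __ := (inferInstance : AddCommGroup (SkewDual R H))
  mul_assoc := mul_assoc'
  one_mul := one_mul'
  mul_one := mul_one'
  left_distrib φ ψ χ := ext fun h => BTensor.hom_congr (f := conv φ (ψ + χ))
    (g := conv φ ψ + conv φ χ) (fun a b => by simp [add_smul]) _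
  right_distrib φ ψ χ := ext fun h => BTensor.hom_congr (f := conv (φ + ψ) χ)
    (g := conv φ χ + conv ψ χ) (fun a b => by simp) _
  zero_mul φ := ext fun h => BTensor.hom_congr (f := conv 0 φ) (g := 0) (fun a b => by simp) _
  mul_zero φ := ext fun h => BTensor.hom_congr (f := conv φ 0) (g := 0) (fun a b => by simp) _

instance : IsScalarTower R (SkewDual R H) (SkewDual R H) where
  smul_assoc r φ ψ := ext fun h => BTensor.hom_congr (f := conv (r • φ) ψ)
    (g := (AddMonoidHom.mulLeft r).comp (conv φ ψ)) (fun a b => by simp) _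

theorem comul_mul_op (h : H) (a : Rᵐᵒᵖ) :
    (comul (R := R) (h * (a • (1 : H)))).1
      = applyTo R (1 : H) (a • (1 : H)) (comul (R := R) h).1 := by
  rw [comul_mul]
  have : (comul (R := R) (a • (1 : H))).1 = BTensor.tmul R (1 : H) (a • (1 : H)) := by
    have := comul_op_smul a.unop (1 : H)
    rw [comul_one] at this
    simpa using this
  rw [this, takeuchiAct_tmul]

instance : IsScalarTower Rᵐᵒᵖ (SkewDual R H) (SkewDual R H) where
  smul_assoc a φ ψ := ext fun h => by
    simp only [smul_eq_mul, op_smul_apply, mul_apply, comul_mul_op]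
    exact BTensor.hom_congr (f := conv (a • φ) ψ)
      (g := (conv φ ψ).comp (applyTo R (1 : H) (a • (1 : H)))) (fun c d => by simp [smul_mul_assoc]) _

section algebra

variable (k : Type*) [CommRing k] [Algebra k R] [Algebra k H] [IsScalarTower k R H]
  [IsScalarTower k Rᵐᵒᵖ H]

variable {k} in
theorem op_algebraMap_smul (c : k) (h : H) : op (algebraMap k R c) • h = c • h := by
  have : op (algebraMap k R c) = c • (1 : Rᵐᵒᵖ) := by
    rw [Algebra.algebraMap_eq_smul_one]; rfl
  rw [this, smul_assoc, one_smul]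

variable {k} in
theorem map_base_smul (φ : SkewDual R H) (c : k) (h : H) : φ (c • h) = algebraMap k R c * φ h := by
  rw [← op_algebraMap_smul (R := R), map_op_smul, Algebra.commutes]

/-- The `k`-algebra structure of the left skew dual. -/
instance : Algebra k (SkewDual R H) :=
  letI : Module k (SkewDual R H) := Module.compHom _ (algebraMap k R)
  Algebra.ofModule (fun c φ ψ => smul_assoc (algebraMap k R c) φ ψ)
    (fun c φ ψ => ext fun h => BTensor.hom_congr (f := conv φ (algebraMap k R c • ψ))
      (g := (AddMonoidHom.mulLeft (algebraMap k R c)).comp (conv φ ψ))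
      (fun a b => by simp [mul_smul, map_base_smul]) _)

variable {k} in
@[simp] theorem base_smul_apply (c : k) (φ : SkewDual R H) (h : H) :
    (c • φ) h = algebraMap k R c * φ h := rfl

instance : IsScalarTower k R (SkewDual R H) where
  smul_assoc c r φ := ext fun h => by
    rw [base_smul_apply, smul_apply, smul_apply, Algebra.smul_def, mul_assoc]

instance : IsScalarTower k Rᵐᵒᵖ (SkewDual R H) where
  smul_assoc c a φ := ext fun h => by
    rw [base_smul_apply, op_smul_apply, op_smul_apply, smul_assoc, mul_smul_comm, map_base_smul]

end algebra

/-! The comultiplication. -/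

section contract

variable {M : Type*} [AddCommGroup M] [Module Rᵐᵒᵖ M]

/-- The contraction `M ⊗_R H^∨ → M`, `m ⊗ ψ ↦ m ψ(g)`. -/
def contract (M : Type*) [AddCommGroup M] [Module Rᵐᵒᵖ M] (g : H) :
    BTensor R M (SkewDual R H) →+ M :=
  BTensor.lift R
    (AddMonoidHom.mk' (fun m => AddMonoidHom.mk' (fun ψ : SkewDual R H => op (ψ g) • m)
        (fun _ _ => by simp [add_smul]))
      (fun _ _ => by ext; simp))
    (fun r m ψ => by simp [mul_smul])

@[simp] theorem contract_tmul (g : H) (m : M) (ψ : SkewDual R H) :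
    contract M g (BTensor.tmul R m ψ) = op (ψ g) • m := BTensor.lift_tmul _ _ m ψ

end contract

variable [Module.Finite Rᵐᵒᵖ H] [Module.Projective Rᵐᵒᵖ H]

variable (R H) in
/-- A finite dual basis: `h = ∑ (eⁱ(h))‾ eᵢ` for all `h`. -/
theorem exists_dualBasis : ∃ (n : ℕ) (e : Fin n → H) (f : Fin n → SkewDual R H),
    ∀ h, ∑ i, op (f i h) • e i = h := by
  obtain ⟨n, p, j, -, -, hpj⟩ := Module.Finite.exists_comp_eq_id_of_projective Rᵐᵒᵖ H
  refine ⟨n, fun i => p (Pi.single i 1), fun i => mk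
    (AddMonoidHom.mk' (fun h => unop (j h i)) (fun a b => by simp)) (fun r h => by simp), ?_⟩
  intro h
  have : p (j h) = h := LinearMap.congr_fun hpj h
  conv_rhs => rw [← this, ← Finset.univ_sum_single (j h), map_sum]
  refine Finset.sum_congr rfl fun i _ => ?_
  simp only [mk_apply, AddMonoidHom.mk'_apply, op_unop]
  rw [← map_smul, ← Pi.single_smul, smul_eq_mul, mul_one]

theorem sum_contract {n : ℕ} {e : Fin n → H} {f : Fin n → SkewDual R H}
    (he : ∀ h, ∑ i, op (f i h) • e i = h) {M : Type*} [AddCommGroup M] [Module Rᵐᵒᵖ M]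
    (w : BTensor R M (SkewDual R H)) :
    ∑ i, BTensor.tmul R (contract M (e i) w) (f i) = w := by
  have := BTensor.hom_congr
    (f := ∑ i, ((BTensor.tmulHom R M (SkewDual R H)).flip (f i)).comp (contract M (e i)))
    (g := .id _) (fun m ψ => ?_) w
  · simpa using this
  · have hψ : ∑ i, ψ (e i) • f i = ψ := by
      ext h
      conv_rhs => rw [← he h, map_sum]
      have : ∀ s : Finset (Fin n), (∑ i ∈ s, ψ (e i) • f i) h = ∑ i ∈ s, ψ (e i) * f i h := by
        intro s
        exact map_sum ((evalHom R H).flip h) _ _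
      rw [this]
      exact Finset.sum_congr rfl fun i _ => (map_op_smul ψ _ _).symm
    simp only [AddMonoidHom.finsetSum_apply, AddMonoidHom.comp_apply, AddMonoidHom.flip_apply,
      contract_tmul, BTensor.tmulHom_apply, BTensor.smul_tmul, AddMonoidHom.id_apply]
    conv_rhs => rw [← hψ]
    exact (map_sum (BTensor.tmulHom R M (SkewDual R H) m) _ _).symm

/-- Elements of `M ⊗_R H^∨` are separated by the contractions. -/
theorem contract_ext {M : Type*} [AddCommGroup M] [Module Rᵐᵒᵖ M]
    {w w' : BTensor R M (SkewDual R H)} (h : ∀ g : H, contract M g w = contract M g w') :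
    w = w' := by
  obtain ⟨n, e, f, he⟩ := exists_dualBasis R H
  rw [← sum_contract he w, ← sum_contract he w']
  simp [h]

variable (R H) in
theorem exists_comulAux :
    ∃ Δ : SkewDual R H →+ BTensor R (SkewDual R H) (SkewDual R H),
      ∀ φ g, contract (SkewDual R H) g (Δ φ) = translate g φ := by
  obtain ⟨n, e, f, he⟩ := exists_dualBasis R H
  refine ⟨∑ i, ((BTensor.tmulHom R (SkewDual R H) (SkewDual R H)).flip (f i)).comp
    (translate (e i)), fun φ g => ?_⟩
  simp only [AddMonoidHom.finsetSum_apply, AddMonoidHom.comp_apply, AddMonoidHom.flip_apply,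
      contract_tmul, BTensor.tmulHom_apply, map_sum]
  ext h
  rw [translate_apply]
  conv_rhs => rw [← he g, Finset.mul_sum, map_sum]
  refine (map_sum ((evalHom R H).flip h) _ _).trans (Finset.sum_congr rfl fun i _ => ?_)
  simp [mul_assoc, smul_mul_assoc]

variable (R H) in
/-- The comultiplication of `H^∨`. By `contract_comulAux` and `contract_ext` it is the unique map
`φ ↦ ∑ φ₁ ⊗ φ₂` with `φ(h g) = ∑ φ₁(h φ₂(g)‾)`; explicitly it is `φ ↦ ∑ φ(- eᵢ) ⊗ eⁱ` for any
finite dual basis `eᵢ`, `eⁱ`. -/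
noncomputable def comulAux : SkewDual R H →+ BTensor R (SkewDual R H) (SkewDual R H) :=
  (exists_comulAux R H).choose

theorem contract_comulAux (φ : SkewDual R H) (g : H) :
    contract (SkewDual R H) g (comulAux R H φ) = translate g φ :=
  (exists_comulAux R H).choose_spec φ g

theorem contract_smul (r : R) (w : BTensor R (SkewDual R H) (SkewDual R H)) (g : H) :
    contract (SkewDual R H) g (r • w) = r • contract (SkewDual R H) g w :=
  BTensor.hom_congr (f := (contract (SkewDual R H) g).comp (DistribSMul.toAddMonoidHom _ r))
    (g := (DistribSMul.toAddMonoidHom _ r).comp (contract (SkewDual R H) g))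
    (fun a b => by simp [smul_comm]) w

theorem contract_op_smul (a : Rᵐᵒᵖ) (w : BTensor R (SkewDual R H) (SkewDual R H)) (g : H) :
    contract (SkewDual R H) g (a • w) = contract (SkewDual R H) (g * (a • (1 : H))) w :=
  BTensor.hom_congr (f := (contract (SkewDual R H) g).comp (DistribSMul.toAddMonoidHom _ a))
    (g := contract (SkewDual R H) (g * (a • (1 : H)))) (fun a b => by simp) w

theorem translate_translate (φ : SkewDual R H) (g h : H) :
    translate g (translate h φ) = translate (g * h) φ := by
  ext; simp [mul_assoc]

theorem comulAux_smul (r : R) (φ : SkewDual R H) :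
    comulAux R H (r • φ) = r • comulAux R H φ := by
  refine contract_ext fun g => ?_
  rw [contract_smul, contract_comulAux, contract_comulAux]
  rfl

theorem comulAux_op_smul (a : Rᵐᵒᵖ) (φ : SkewDual R H) :
    comulAux R H (a • φ) = a • comulAux R H φ := by
  refine contract_ext fun g => ?_
  rw [contract_op_smul, contract_comulAux, contract_comulAux, ← translate_translate]
  rfl

theorem mul_op_smul_one_apply (φ : SkewDual R H) (r : R) (h : H) :
    (φ * (op r • (1 : SkewDual R H))) h = φ (h * (r • (1 : H))) := by
  have h₁ := BTensor.hom_congr (f := conv φ (op r • (1 : SkewDual R H)))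
    (g := (conv φ 1).comp (applyTo R (op r • (1 : H)) 1)) (fun a b => by simp)
    (comul (R := R) h).1
  have h₂ := BTensor.hom_congr (f := conv (translate (r • (1 : H)) φ) 1)
    (g := (conv φ 1).comp (applyTo R 1 (r • (1 : H)))) (fun a b => by simp [smul_mul_assoc])
    (comul (R := R) h).1
  rw [mul_apply, h₁, ← translate_apply, ← mul_one (translate (r • (1 : H)) φ), mul_apply, h₂]
  exact congrArg (conv φ 1) ((comul (R := R) h).2 r)

theorem mul_smul_one_apply (φ : SkewDual R H) (r : R) (h : H) :
    (φ * (r • (1 : SkewDual R H))) h = φ (r • h) := by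
  let φ' : SkewDual R H := mk ((φ : H →+ R).comp (DistribSMul.toAddMonoidHom H r))
      (fun s h => by simp [smul_comm r (op s) h])
  have : φ (r • h) = (φ' * 1) h := by rw [mul_one]; rfl
  rw [this, mul_apply, mul_apply]
  exact BTensor.hom_congr (f := conv φ (r • (1 : SkewDual R H))) (g := conv φ' 1)
    (fun a b => by simp [φ', mul_smul]) _

theorem comulAux_mem (φ : SkewDual R H) :
    comulAux R H φ ∈ takeuchiProduct R (SkewDual R H) := by
  intro r
  refine contract_ext fun g => ?_
  have h₁ : ∀ w, contract (SkewDual R H) g (applyTo R (op r • (1 : SkewDual R H)) 1 w)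
      = contract (SkewDual R H) g w * (op r • (1 : SkewDual R H)) :=
    BTensor.hom_congr (f := (contract (SkewDual R H) g).comp (applyTo R _ _))
      (g := (AddMonoidHom.mulRight _).comp (contract (SkewDual R H) g))
      (fun a b => by simp [smul_mul_assoc])
  have h₂ : ∀ w, contract (SkewDual R H) g (applyTo R 1 (r • (1 : SkewDual R H)) w)
      = contract (SkewDual R H) (r • g) w :=
    BTensor.hom_congr (f := (contract (SkewDual R H) g).comp (applyTo R _ _))
      (g := contract (SkewDual R H) (r • g))
      (fun a b => by
        simp only [AddMonoidHom.comp_apply, applyTo_tmul, contract_tmul, smul_eq_mul, mul_one,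
          mul_smul_one_apply])
  rw [h₁, h₂, contract_comulAux, contract_comulAux]
  ext h
  rw [mul_op_smul_one_apply]
  simp [mul_assoc]

theorem contract_sum {ι : Type*} {M : Type*} [AddCommGroup M] [Module Rᵐᵒᵖ M] (s : Finset ι)
    (g : ι → H) (w : BTensor R M (SkewDual R H)) :
    contract M (∑ i ∈ s, g i) w = ∑ i ∈ s, contract M (g i) w := by
  have := BTensor.hom_congr (f := contract M (∑ i ∈ s, g i)) (g := ∑ i ∈ s, contract M (g i))
    (fun m ψ => by simp [Finset.sum_smul]) w
  simpa using this

/-- The contraction of a product in `H^∨ ⊗_R H^∨`. -/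
theorem contract_applyTo (ψ₁ ψ₂ : SkewDual R H) (g : H) (s : Finset (H × H))
    (hg : (comul (R := R) g).1 = ∑ p ∈ s, BTensor.tmul R p.1 p.2)
    (w : BTensor R (SkewDual R H) (SkewDual R H)) :
    contract (SkewDual R H) g (applyTo R ψ₁ ψ₂ w)
      = ∑ p ∈ s, contract (SkewDual R H) (ψ₂ p.1 • p.2) w * ψ₁ := by
  have := BTensor.hom_congr (f := (contract (SkewDual R H) g).comp (applyTo R ψ₁ ψ₂))
    (g := ∑ p ∈ s, (AddMonoidHom.mulRight ψ₁).comp (contract (SkewDual R H) (ψ₂ p.1 • p.2)))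
    (fun φ₁ φ₂ => by
      simp only [AddMonoidHom.finsetSum_apply, AddMonoidHom.comp_apply, contract_tmul,
        applyTo_tmul, smul_eq_mul, mul_apply, hg, map_sum, conv_tmul,
        AddMonoidHom.mulRight_apply, smul_mul_assoc, Finset.op_sum, Finset.sum_smul]) w
  simpa using this

theorem conv_zero_right (φ : SkewDual R H) (x : BTensor R H H) : conv φ 0 x = 0 :=
  BTensor.hom_congr (f := conv φ 0) (g := 0) (fun a b => by simp) x

theorem conv_add_right (φ ψ χ : SkewDual R H) (x : BTensor R H H) :
    conv φ (ψ + χ) x = conv φ ψ x + conv φ χ x :=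
  BTensor.hom_congr (f := conv φ (ψ + χ)) (g := conv φ ψ + conv φ χ)
    (fun a b => by simp [add_smul]) x

theorem comulAux_mul (φ ψ : SkewDual R H) :
    comulAux R H (φ * ψ) = takeuchiAct ⟨comulAux R H φ, comulAux_mem φ⟩ (comulAux R H ψ) := by
  refine contract_ext fun g => ?_
  rw [contract_comulAux]
  ext h
  obtain ⟨s, hs⟩ := BTensor.exists_sum_tmul (comul (R := R) g).1
  have key : ∀ z, contract (SkewDual R H) g
      (takeuchiAct ⟨comulAux R H φ, comulAux_mem φ⟩ z) h
      = ∑ p ∈ s, conv (translate p.2 φ) (contract (SkewDual R H) p.1 z) (comul (R := R) h).1 := by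
    intro z
    induction z using BTensor.induction with
    | zero => simp [conv_zero_right]
    | add z z' hz hz' =>
      simp only [map_add, add_apply, hz, hz', conv_add_right, Finset.sum_add_distrib]
    | tmul ψ₁ ψ₂ =>
      rw [takeuchiAct_tmul, contract_applyTo ψ₁ ψ₂ g s hs]
      refine (map_sum ((evalHom R H).flip h) _ _).trans (Finset.sum_congr rfl fun p _ => ?_)
      rw [contract_comulAux, contract_tmul]
      have h₁ := BTensor.hom_congr (f := conv (translate (ψ₂ p.1 • p.2) φ) ψ₁)
        (g := (conv (translate p.2 φ) ψ₁).comp (applyTo R 1 (ψ₂ p.1 • (1 : H))))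
        (fun a b => by simp [smul_mul_assoc, mul_assoc]) (comul (R := R) h).1
      have h₂ := BTensor.hom_congr (f := conv (translate p.2 φ) (op (ψ₂ p.1) • ψ₁))
        (g := (conv (translate p.2 φ) ψ₁).comp (applyTo R (op (ψ₂ p.1) • (1 : H)) 1))
        (fun a b => by simp) (comul (R := R) h).1
      rw [h₂]
      refine h₁.trans ?_
      exact (congrArg (conv (translate p.2 φ) ψ₁) ((comul (R := R) h).2 (ψ₂ p.1))).symm
  rw [key, translate_apply, mul_apply, comul_mul, hs, map_sum, map_sum]
  refine Finset.sum_congr rfl fun p _ => ?_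
  rw [contract_comulAux, takeuchiAct_tmul]
  exact BTensor.hom_congr (f := (conv φ ψ).comp (applyTo R p.1 p.2))
    (g := conv (translate p.2 φ) (translate p.1 ψ)) (fun a b => by simp [smul_mul_assoc]) _

theorem counit_mul_op (g h : H) :
    counit (R := R) (g * h) = counit (R := R) (g * (op (counit (R := R) h) • (1 : H))) := by
  rw [counit_mul, counit_mul g (op (counit (R := R) h) • (1 : H)), counit_op_smul, counit_one,
    one_mul]

/-- The left skew dual of a left finite `×_R`-bialgebra, as a `×_R`-bialgebra; its counit is
`φ ↦ φ(1)`. -/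
noncomputable instance : TakeuchiBialgebra R (SkewDual R H) where
  comul := AddMonoidHom.mk' (fun φ => ⟨comulAux R H φ, comulAux_mem φ⟩)
    (fun φ ψ => Subtype.ext (map_add (comulAux R H) φ ψ))
  counit := (evalHom R H).flip 1
  comul_smul := comulAux_smul
  comul_op_smul r := comulAux_op_smul (op r)
  counit_smul r φ := rfl
  counit_op_smul r φ := by simp
  coassoc φ := by
    refine contract_ext fun g => ?_
    have h₁ : ∀ (Δ : SkewDual R H →ₗ[Rᵐᵒᵖ] BTensor R (SkewDual R H) (SkewDual R H)) w,
        contract (BTensor R (SkewDual R H) (SkewDual R H)) g (BTensor.map Δ LinearMap.id w)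
        = Δ (contract (SkewDual R H) g w) := fun Δ =>
      BTensor.hom_congr (f := (contract _ g).comp (BTensor.map Δ LinearMap.id))
        (g := Δ.toAddMonoidHom.comp (contract (SkewDual R H) g)) (fun a b => by simp)
    have h₂ : ∀ χ w, contract (BTensor R (SkewDual R H) (SkewDual R H)) g
        (BTensor.assocAux (SkewDual R H) χ w)
        = BTensor.tmul R χ (contract (SkewDual R H) g w) := fun χ =>
      BTensor.hom_congr (f := (contract _ g).comp (BTensor.assocAux (SkewDual R H) χ))
        (g := (BTensor.tmulHom R _ _ χ).comp (contract (SkewDual R H) g)) (fun a b => by simp)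
    rw [h₁]
    refine contract_ext fun g' => ?_
    refine Eq.trans (b := translate (g' * g) φ) ?_ ?_
    · refine (congrArg (fun χ => contract (SkewDual R H) g' (comulAux R H χ))
        (contract_comulAux φ g)).trans ?_
      exact (contract_comulAux (translate g φ) g').trans (translate_translate φ g' g)
    · rw [← contract_comulAux]
      refine BTensor.hom_congr (f := contract (SkewDual R H) (g' * g))
        (g := (contract _ g').comp ((contract _ g).comp
          ((BTensor.assocInv _ _ _).comp (BTensor.map _ _)))) (fun a b => ?_) (comulAux R H φ)
      simp only [AddMonoidHom.comp_apply, BTensor.map_tmul, BTensor.assocInv_tmul, h₂,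
        contract_tmul, LinearMap.id_apply]
      congr 2
      exact (DFunLike.congr_fun (contract_comulAux b g) g').symm
  counit_left φ := by
    ext g
    have : (contract (SkewDual R H) g (comulAux R H φ)) 1 = φ g := by
      rw [contract_comulAux, translate_apply, _root_.one_mul]
    rw [← this]
    refine BTensor.hom_congr (f := ((evalHom R H).flip g).comp (BTensor.lift R _ _))
      (g := ((evalHom R H).flip 1).comp (contract (SkewDual R H) g)) (fun a b => ?_)
      (comulAux R H φ)
    simp
  counit_right φ := by
    have : contract (SkewDual R H) 1 (comulAux R H φ) = φ := by
      rw [contract_comulAux]; ext; simp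
    conv_rhs => rw [← this]
    refine BTensor.hom_congr (f := BTensor.lift R _ _)
      (g := contract (SkewDual R H) 1) (fun a b => ?_) (comulAux R H φ)
    simp only [BTensor.lift_tmul, contract_tmul]
    rfl
  comul_one := by
    refine contract_ext fun g => ?_
    refine (contract_comulAux 1 g).trans ?_
    ext h
    rw [contract_tmul, translate_apply, op_smul_apply, one_apply, one_apply, one_apply,
      counit_mul_op]
  comul_mul := comulAux_mul
  counit_one := counit_one
  counit_mul φ ψ := by
    change (φ * ψ) 1 = (φ * (ψ 1 • (1 : SkewDual R H))) 1
    rw [mul_smul_one_apply, mul_apply, comul_one, conv_tmul]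

end SkewDual

end SkewDual

/-! ### Module categories, inner hom-functors, and the Hopf conditions

Morphisms are written as additive maps with a linearity property. In a monoidal category, a right
inner hom-object `hom_r(M, N)`, that is, a value at `N` of a right adjoint of `- ⊗ M`, is an object
`P` with a universal morphism `P ⊗ M → N`; a left inner hom-object `hom_l(M, N)` is an object `P`
with a universal morphism `M ⊗ P → N`. -/

section Hopf

/-- An `R^e`-module, that is, an `R`-bimodule on which the two actions of `k` agree. -/
structure Bimodule (k : Type v) (R : Type u) [CommRing k] [Ring R] [Algebra k R] :
    Type (max (u + 1) v) where
  carrier : Type u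
  [addCommGroup : AddCommGroup carrier]
  [moduleBase : Module k carrier]
  [moduleLeft : Module R carrier]
  [moduleRight : Module Rᵐᵒᵖ carrier]
  [comm : SMulCommClass R Rᵐᵒᵖ carrier]
  [towerLeft : IsScalarTower k R carrier]
  [towerRight : IsScalarTower k Rᵐᵒᵖ carrier]

instance (k : Type v) (R : Type u) [CommRing k] [Ring R] [Algebra k R] :
    CoeSort (Bimodule k R) (Type u) := ⟨Bimodule.carrier⟩

attribute [instance] Bimodule.addCommGroup Bimodule.moduleBase Bimodule.moduleLeft
  Bimodule.moduleRight Bimodule.comm Bimodule.towerLeft Bimodule.towerRight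

/-- A left `H`-module, together with the induced actions of `R` and `R̄`. -/
structure LeftModule (R H : Type u) [Ring R] [Ring H] [Module R H] [Module Rᵐᵒᵖ H] :
    Type (u + 1) where
  carrier : Type u
  [addCommGroup : AddCommGroup carrier]
  [module : Module H carrier]
  [moduleLeft : Module R carrier]
  [moduleRight : Module Rᵐᵒᵖ carrier]
  [towerLeft : IsScalarTower R H carrier]
  [towerRight : IsScalarTower Rᵐᵒᵖ H carrier]

instance (R H : Type u) [Ring R] [Ring H] [Module R H] [Module Rᵐᵒᵖ H] :
    CoeSort (LeftModule R H) (Type u) := ⟨LeftModule.carrier⟩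

attribute [instance] LeftModule.addCommGroup LeftModule.module LeftModule.moduleLeft
  LeftModule.moduleRight LeftModule.towerLeft LeftModule.towerRight

variable (k : Type v) (R H : Type u) [CommRing k] [Ring R] [Algebra k R] [Ring H]
  [Module R H] [Module Rᵐᵒᵖ H] [IsScalarTower R H H] [IsScalarTower Rᵐᵒᵖ H H]
  [SMulCommClass R Rᵐᵒᵖ H]

instance (M : LeftModule R H) : SMulCommClass R Rᵐᵒᵖ M where
  smul_comm r a m := by
    have h₁ : r • a • m = (r • a • (1 : H)) • m := by simp
    have h₂ : a • r • m = (a • r • (1 : H)) • m := by simp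
    rw [h₁, h₂, smul_comm]

/-- Morphisms of `R^e`-modules. -/
def IsBimoduleHom {A B : Type*} [AddCommGroup A] [AddCommGroup B] [Module R A] [Module Rᵐᵒᵖ A]
    [Module R B] [Module Rᵐᵒᵖ B] (f : A →+ B) : Prop :=
  (∀ (r : R) (a : A), f (r • a) = r • f a) ∧ ∀ (r : R) (a : A), f (op r • a) = op r • f a

/-- Morphisms `M ⊗_R N → P` of left `H`-modules, where `H` acts on `M ⊗_R N` diagonally,
`h (m ⊗ n) = ∑ h₁ m ⊗ h₂ n`. -/
def IsTensorHom [TakeuchiBialgebra R H] {M N P : LeftModule R H} (f : BTensor R M N →+ P) : Prop :=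
  ∀ (h : H) (x : BTensor R M N), f (takeuchiAct (TakeuchiBialgebra.comul h) x) = h • f x

variable {R H} in
/-- `P` with `ev : P ⊗ M → N` is a right inner hom-object `hom_r(M, N)` of left `H`-modules. -/
def IsRightInnerHom [TakeuchiBialgebra R H] {M N P : LeftModule R H}
    (ev : BTensor R P M →+ N) : Prop :=
  IsTensorHom R H ev ∧
    ∀ (Z : LeftModule R H) (f : BTensor R Z M →+ N), IsTensorHom R H f →
      ∃! g : Z →ₗ[H] P, ∀ z m, ev (BTensor.tmul R (g z) m) = f (BTensor.tmul R z m)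

variable {R H} in
/-- The underlying `R^e`-module of `P` with the underlying map of `ev : P ⊗ M → N` is a right
inner hom-object `hom_r(M, N)` of `R^e`-modules. -/
def IsUnderlyingRightInnerHom {M N P : LeftModule R H} (ev : BTensor R P M →+ N) : Prop :=
  IsBimoduleHom R ev ∧
    ∀ (Z : Bimodule k R) (f : BTensor R Z M →+ N), IsBimoduleHom R f →
      ∃! g : Z →+ P, IsBimoduleHom R g ∧
        ∀ z m, ev (BTensor.tmul R (g z) m) = f (BTensor.tmul R z m)

variable {R H} in
/-- `P` with `ev : M ⊗ P → N` is a left inner hom-object `hom_l(M, N)` of left `H`-modules. -/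
def IsLeftInnerHom [TakeuchiBialgebra R H] {M N P : LeftModule R H}
    (ev : BTensor R M P →+ N) : Prop :=
  IsTensorHom R H ev ∧
    ∀ (Z : LeftModule R H) (f : BTensor R M Z →+ N), IsTensorHom R H f →
      ∃! g : Z →ₗ[H] P, ∀ m z, ev (BTensor.tmul R m (g z)) = f (BTensor.tmul R m z)

variable {R H} in
/-- The underlying `R^e`-module of `P` with the underlying map of `ev : M ⊗ P → N` is a left
inner hom-object `hom_l(M, N)` of `R^e`-modules. -/
def IsUnderlyingLeftInnerHom {M N P : LeftModule R H} (ev : BTensor R M P →+ N) : Prop :=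
  IsBimoduleHom R ev ∧
    ∀ (Z : Bimodule k R) (f : BTensor R M Z →+ N), IsBimoduleHom R f →
      ∃! g : Z →+ P, IsBimoduleHom R g ∧
        ∀ m z, ev (BTensor.tmul R m (g z)) = f (BTensor.tmul R m z)

/-- The `×_R`-bialgebra `H` is `×_R`-Hopf: the underlying functor from left `H`-modules to
`R^e`-modules preserves right inner hom-functors. -/
def IsHopf [TakeuchiBialgebra R H] : Prop :=
  ∀ (M N P : LeftModule R H) (ev : BTensor R P M →+ N),
    IsRightInnerHom ev → IsUnderlyingRightInnerHom k ev

/-- The `×_R`-bialgebra `H` is `×_R`-anti-Hopf: the underlying functor from left `H`-modules to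
`R^e`-modules preserves left inner hom-functors. Equivalently the coopposite is `×_{R̄}`-Hopf,
its module category being the same with the order of tensor products reversed. -/
def IsAntiHopf [TakeuchiBialgebra R H] : Prop :=
  ∀ (M N P : LeftModule R H) (ev : BTensor R M P →+ N),
    IsLeftInnerHom ev → IsUnderlyingLeftInnerHom k ev

end Hopf

end Takeuchi

/-! For a dual basis eᵢ, eⁱ of `H` over R̄, the comultiplication of H^∨ is Δ(φ) = ∑ φ(- eᵢ) ⊗ eⁱ.
The proof constructs an inverse, in a suitable sense, of the canonical element ∑ eᵢ ⊗ eⁱ, and hence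
of the Galois-type map φ ⊗ m ↦ ∑ φ₁ ⊗ φ₂ m.

By `isHopf_of_existsUnique_extension` it is enough that every R̄-linear map l : M → N between
H^∨-modules has a unique H^∨-linear extension F : H^∨ ⊗ M → N with F(1 ⊗ m) = l(m).

The inverse comes from the anti-Hopf property. The left inner hom of `H`-modules is Hom_H(M ⊗ H, N),
so its preservation says that each R-linear map M → N is m ↦ F(m ⊗ 1) for exactly one `H`-linear F :
M ⊗ H → N (`existsUnique_tensorHom`). For M = H this gives two facts: the elements ∑ g₁ b ⊗ g₂
generate H ⊗ H, and each left R-linear p : H → R yields T_p : H ⊗ H → H with T_p(∑ g₁ b ⊗ g₂) = g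
p(b). Set S_p(h) = ε(T_p(1 ⊗ h)); this is an element of H^∨.

Let qⱼ, pⱼ be a dual basis of `H` over R, available by right finiteness, and let Sⱼ be S_p for p =
pⱼ. Then ∑ Sⱼ ⊗ qⱼ is the inverse: ∑ eᵢ qⱼ ⊗ eⁱ Sⱼ = 1 ⊗ 1, ∑ Sⱼ eⁱ ⊗ qⱼ eᵢ = 1 ⊗ 1, ∑ Sⱼ ⊗ qⱼ r̄ =
∑ Sⱼ r ⊗ qⱼ. The extension is F(φ ⊗ m) = ∑ φ(- qⱼ) l(Sⱼ m). The third identity makes it well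
defined, the second gives F(φ · (1 ⊗ m)) = φ l(m), and the first gives φ ⊗ m = ∑ φ(- qⱼ) · (1 ⊗ Sⱼ
m). Thus the elements φ · (1 ⊗ m) span, which yields both linearity and uniqueness of F. -/

namespace Takeuchi

open TakeuchiBialgebra

/-! ### Induced bimodule structures and the diagonal action on tensor products -/

section Modules

/-- The left `H`-module with the given `H`-action and the induced actions of `R` and `R̄`. -/
@[reducible] def LeftModule.ofModule (R H : Type u) [Ring R] [Ring H] [Module R H]
    [Module Rᵐᵒᵖ H] [IsScalarTower R H H] [IsScalarTower Rᵐᵒᵖ H H] (X : Type u) [AddCommGroup X]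
    [Module H X] : LeftModule R H :=
  letI : Module R X := Module.compHom X (RingHom.smulOneHom : R →+* H)
  letI : Module Rᵐᵒᵖ X := Module.compHom X (RingHom.smulOneHom : Rᵐᵒᵖ →+* H)
  { carrier := X
    towerLeft := ⟨fun r h x => by
      change (r • h) • x = (r • (1 : H)) • h • x
      rw [← mul_smul, smul_mul_assoc, one_mul]⟩
    towerRight := ⟨fun r h x => by
      change (r • h) • x = (r • (1 : H)) • h • x
      rw [← mul_smul, smul_mul_assoc, one_mul]⟩ }

/-- An `R`-bimodule on which the images of `k` in `R` and `R̄` act in the same way. -/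
@[reducible] def Bimodule.ofCentral (k : Type v) {R : Type u} [CommRing k] [Ring R] [Algebra k R]
    (X : Type u) [AddCommGroup X] [Module R X] [Module Rᵐᵒᵖ X] [SMulCommClass R Rᵐᵒᵖ X]
    (hX : ∀ (c : k) (x : X), op (algebraMap k R c) • x = algebraMap k R c • x) : Bimodule k R :=
  letI : Module k X := Module.compHom X (algebraMap k R)
  { carrier := X
    towerLeft := ⟨fun c r x => by
      change (c • r) • x = algebraMap k R c • r • x
      rw [← mul_smul, Algebra.smul_def]⟩
    towerRight := ⟨fun c a x => by
      change (c • a) • x = algebraMap k R c • a • x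
      rw [← hX, ← mul_smul]
      congr 1
      rw [← unop_inj, unop_smul, unop_mul, unop_op, Algebra.smul_def, Algebra.commutes]⟩ }

variable {R H : Type u} [Ring R] [Ring H] [Module R H] [Module Rᵐᵒᵖ H]

/-- The map `m ⊗ h ↦ m ⊗ h n`. -/
def idTensorSMul (M : Type*) [AddCommGroup M] [Module Rᵐᵒᵖ M] {N : Type*} [AddCommGroup N]
    [Module H N] [Module R N] [IsScalarTower R H N] (n : N) : BTensor R M H →+ BTensor R M N :=
  BTensor.map LinearMap.id ((LinearMap.toSpanSingleton H N n).restrictScalars R)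

@[simp] theorem idTensorSMul_tmul {M : Type*} [AddCommGroup M] [Module Rᵐᵒᵖ M] {N : Type*}
    [AddCommGroup N] [Module H N] [Module R N] [IsScalarTower R H N] (n : N) (m : M) (h : H) :
    idTensorSMul M n (BTensor.tmul R m h) = BTensor.tmul R m (h • n) :=
  BTensor.map_tmul _ _ m h

/-- The map `h ⊗ n ↦ h m ⊗ n`. -/
def smulTensorId {M : Type*} [AddCommGroup M] [Module H M] [Module Rᵐᵒᵖ M]
    [IsScalarTower Rᵐᵒᵖ H M] (N : Type*) [AddCommGroup N] [Module R N] (m : M) :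
    BTensor R H N →+ BTensor R M N :=
  BTensor.map ((LinearMap.toSpanSingleton H M m).restrictScalars Rᵐᵒᵖ) LinearMap.id

@[simp] theorem smulTensorId_tmul {M : Type*} [AddCommGroup M] [Module H M] [Module Rᵐᵒᵖ M]
    [IsScalarTower Rᵐᵒᵖ H M] {N : Type*} [AddCommGroup N] [Module R N] (m : M) (h : H) (n : N) :
    smulTensorId N m (BTensor.tmul R h n) = BTensor.tmul R (h • m) n :=
  BTensor.map_tmul _ _ h n

variable [IsScalarTower R H H] [IsScalarTower Rᵐᵒᵖ H H]

/-- Both sides act through `c • (1 : H)`, since k → R → H and k → R̄ → H coincide. Hence the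
bimodule underlying an `H`-module may serve as a test object in `Bimodule k R`. -/
theorem op_algebraMap_smul_module {k : Type v} [CommRing k] [Algebra k R] [Algebra k H]
    [IsScalarTower k R H] [IsScalarTower k Rᵐᵒᵖ H] {M : Type*} [AddCommGroup M] [Module H M]
    [Module R M] [Module Rᵐᵒᵖ M] [IsScalarTower R H M] [IsScalarTower Rᵐᵒᵖ H M] (c : k) (m : M) :
    op (algebraMap k R c) • m = algebraMap k R c • m := by
  have h₁ : op (algebraMap k R c) • (1 : H) = algebraMap k R c • (1 : H) := by
    rw [algebraMap_smul]
    have : op (algebraMap k R c) = c • (1 : Rᵐᵒᵖ) := by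
      rw [Algebra.algebraMap_eq_smul_one]; rfl
    rw [this, smul_assoc, one_smul]
  rw [← one_smul H m, ← smul_assoc, ← smul_assoc, h₁]

section act

variable {M N M' N' : Type*} [AddCommGroup M] [Module H M] [AddCommGroup N] [Module H N]
  [Module Rᵐᵒᵖ M] [IsScalarTower Rᵐᵒᵖ H M] [Module R N] [IsScalarTower R H N]
  [AddCommGroup M'] [Module H M'] [AddCommGroup N'] [Module H N']
  [Module Rᵐᵒᵖ M'] [IsScalarTower Rᵐᵒᵖ H M'] [Module R N'] [IsScalarTower R H N']

/-- This is associativity of the action, (x w)(m ⊗ n) = x (w (m ⊗ n)). Together with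
multiplicativity of Δ it makes the diagonal action a module structure. -/
theorem applyTo_takeuchiAct (m : M) (n : N) (x : takeuchiProduct R H) (w : BTensor R H H) :
    applyTo R m n (takeuchiAct x w) = takeuchiAct x (applyTo R m n w) :=
  BTensor.hom_congr (f := (applyTo R m n).comp (takeuchiAct x))
    (g := (takeuchiAct x).comp (applyTo R m n)) (fun a b => by
      simp only [AddMonoidHom.comp_apply, takeuchiAct_tmul, applyTo_tmul]
      exact BTensor.hom_congr (f := (applyTo R m n).comp (applyTo R a b))
        (g := applyTo R (a • m) (b • n)) (fun c d => by simp [mul_smul]) x.1) w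

theorem map_takeuchiAct (f : M →ₗ[Rᵐᵒᵖ] M') (g : N →ₗ[R] N')
    (hf : ∀ (h : H) m, f (h • m) = h • f m) (hg : ∀ (h : H) n, g (h • n) = h • g n)
    (x : takeuchiProduct R H) (w : BTensor R M N) :
    BTensor.map f g (takeuchiAct x w) = takeuchiAct x (BTensor.map f g w) :=
  BTensor.hom_congr (f := (BTensor.map f g).comp (takeuchiAct x))
    (g := (takeuchiAct x).comp (BTensor.map f g)) (fun a b => by
      simp only [AddMonoidHom.comp_apply, takeuchiAct_tmul, BTensor.map_tmul]
      exact BTensor.hom_congr (f := (BTensor.map f g).comp (applyTo R a b))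
        (g := applyTo R (f a) (g b)) (fun c d => by simp [hf, hg]) x.1) w

variable [SMulCommClass R Rᵐᵒᵖ H] [TakeuchiBialgebra R H]

theorem takeuchiAct_comul_one (w : BTensor R M N) :
    takeuchiAct (comul (R := R) (1 : H)) w = w :=
  BTensor.hom_congr (f := takeuchiAct (comul (R := R) (1 : H))) (g := .id _)
    (fun m n => by simp [comul_one]) w

theorem takeuchiAct_comul_mul (g h : H) (w : BTensor R M N) :
    takeuchiAct (comul (R := R) (g * h)) w
      = takeuchiAct (comul (R := R) g) (takeuchiAct (comul (R := R) h) w) :=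
  BTensor.hom_congr (f := takeuchiAct (comul (R := R) (g * h)))
    (g := (takeuchiAct (comul (R := R) g)).comp (takeuchiAct (comul (R := R) h)))
    (fun m n => by simp [comul_mul, applyTo_takeuchiAct]) w

theorem takeuchiAct_comul_smul_one [Module R M] [IsScalarTower R H M] [SMulCommClass R Rᵐᵒᵖ M]
    (r : R) (w : BTensor R M N) :
    takeuchiAct (comul (R := R) (r • (1 : H))) w = r • w :=
  BTensor.hom_congr (f := takeuchiAct (comul (R := R) (r • (1 : H))))
    (g := DistribSMul.toAddMonoidHom _ r) (fun m n => by simp [comul_smul, comul_one]) w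

theorem takeuchiAct_comul_op_smul_one [Module Rᵐᵒᵖ N] [IsScalarTower Rᵐᵒᵖ H N]
    [SMulCommClass R Rᵐᵒᵖ N] (r : R) (w : BTensor R M N) :
    takeuchiAct (comul (R := R) (op r • (1 : H))) w = op r • w :=
  BTensor.hom_congr (f := takeuchiAct (comul (R := R) (op r • (1 : H))))
    (g := DistribSMul.toAddMonoidHom _ (op r)) (fun m n => by simp [comul_op_smul, comul_one]) w

variable (R H M N) in
/-- The diagonal action of `H` on `M ⊗_R N`. -/
@[reducible] def diagonalModule : Module H (BTensor R M N) where
  smul h := takeuchiAct (comul (R := R) h)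
  one_smul := takeuchiAct_comul_one
  mul_smul := takeuchiAct_comul_mul
  smul_zero h := map_zero (takeuchiAct (comul (R := R) h))
  smul_add h := map_add (takeuchiAct (comul (R := R) h))
  add_smul g h w := BTensor.hom_congr (f := takeuchiAct (comul (R := R) (g + h)))
    (g := takeuchiAct (comul (R := R) g) + takeuchiAct (comul (R := R) h))
    (fun m n => by simp) w
  zero_smul w := BTensor.hom_congr (f := takeuchiAct (comul (R := R) (0 : H))) (g := 0)
    (fun m n => by simp) w

end act

end Modules

/-! ### Left inner homs of `H`-modules and what the anti-Hopf property says about them -/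

section LeftInnerHom

variable {R H : Type u} [Ring R] [Ring H] [Module R H] [Module Rᵐᵒᵖ H]
  [IsScalarTower R H H] [IsScalarTower Rᵐᵒᵖ H H] [SMulCommClass R Rᵐᵒᵖ H]

variable (R H) in
/-- `H` as a left module over itself. -/
@[reducible] def regularModule : LeftModule R H where
  carrier := H

/-- The `R`-bimodule of left `R`-linear maps, `(r f s)(m) = f(m r) s`. -/
def HomBimodule (M N : LeftModule R H) : Type u := M →ₗ[R] N

namespace HomBimodule

variable (M N : LeftModule R H)

instance : AddCommGroup (HomBimodule M N) := inferInstanceAs (AddCommGroup (M →ₗ[R] N))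

instance : FunLike (HomBimodule M N) M N := inferInstanceAs (FunLike (M →ₗ[R] N) M N)

instance : LinearMapClass (HomBimodule M N) R M N :=
  inferInstanceAs (LinearMapClass (M →ₗ[R] N) R M N)

instance : Module Rᵐᵒᵖ (HomBimodule M N) := inferInstanceAs (Module Rᵐᵒᵖ (M →ₗ[R] N))

instance : Module R (HomBimodule M N) where
  smul r f :=
    haveI : SMulCommClass Rᵐᵒᵖ R M := SMulCommClass.symm _ _ _
    LinearMap.comp f (DistribSMul.toLinearMap R M (op r))
  one_smul f := DFunLike.ext _ _ fun m => by
    change f ((1 : Rᵐᵒᵖ) • m) = f m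
    rw [one_smul]
  mul_smul r s f := DFunLike.ext _ _ fun m => by
    change f ((op s * op r) • m) = f (op s • op r • m)
    rw [mul_smul]
  smul_zero r := rfl
  smul_add r f g := rfl
  add_smul r s f := DFunLike.ext _ _ fun m => by
    change f ((op r + op s) • m) = f (op r • m) + f (op s • m)
    rw [add_smul, map_add]
  zero_smul f := DFunLike.ext _ _ fun m => by
    change f ((0 : Rᵐᵒᵖ) • m) = 0
    rw [zero_smul, map_zero]

variable {M N}

theorem smul_apply (r : R) (f : HomBimodule M N) (m : M) : (r • f) m = f (op r • m) := rfl

theorem op_smul_apply (a : Rᵐᵒᵖ) (f : HomBimodule M N) (m : M) : (a • f) m = a • f m := rfl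

theorem add_apply (f g : HomBimodule M N) (m : M) : (f + g) m = f m + g m := rfl

instance : SMulCommClass R Rᵐᵒᵖ (HomBimodule M N) := ⟨fun _ _ _ => rfl⟩

end HomBimodule

variable [TakeuchiBialgebra R H]

/-- The additive group of `H`-linear maps `M ⊗_R H → N`. -/
def tensorHomSubgroup (M N : LeftModule R H) : AddSubgroup (BTensor R M H →+ N) where
  carrier := {F | IsTensorHom R H (N := regularModule R H) F}
  zero_mem' h x := by simp
  add_mem' hF hG h x := by simp [hF h x, hG h x]
  neg_mem' hF h x := by simp [hF h x]

theorem idTensorSMul_takeuchiAct (M N : LeftModule R H) (n : N) (h : H) (x : BTensor R M H) :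
    idTensorSMul M n (takeuchiAct (comul (R := R) h) x)
      = takeuchiAct (comul (R := R) h) (idTensorSMul M n x) :=
  map_takeuchiAct _ _ (fun _ _ => rfl) (fun g n => by simp [mul_smul]) _ x

/-- Right multiplication on the factor `H` commutes with the diagonal left action, so precomposing
with it preserves linearity and turns the right action into a left one. -/
instance (M N : LeftModule R H) : Module H (tensorHomSubgroup M N) where
  smul g F := ⟨F.1.comp (idTensorSMul M g), fun h x => by
    rw [AddMonoidHom.comp_apply, idTensorSMul_takeuchiAct M (regularModule R H) g h x, F.2]; rfl⟩
  one_smul F := Subtype.ext (BTensor.hom_ext fun m h => by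
    change F.1 (idTensorSMul M (1 : H) _) = _
    simp)
  mul_smul g g' F := Subtype.ext (BTensor.hom_ext fun m h => by
    change F.1 (idTensorSMul M (g * g') _) = F.1 (idTensorSMul M g' (idTensorSMul M g _))
    simp [mul_assoc])
  smul_zero g := rfl
  smul_add g F G := rfl
  add_smul g g' F := Subtype.ext (BTensor.hom_ext fun m h => by
    change F.1 (idTensorSMul M (g + g') _) = F.1 (idTensorSMul M g _) + F.1 (idTensorSMul M g' _)
    simp [mul_add, BTensor.tmul_add])
  zero_smul F := Subtype.ext (BTensor.hom_ext fun m h => by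
    change F.1 (idTensorSMul M (0 : H) _) = 0
    simp only [idTensorSMul_tmul, smul_zero]
    exact (congrArg F.1 (map_zero (BTensor.tmulHom R M H m))).trans (map_zero _))

theorem tensorHom_smul_tmul (M N : LeftModule R H) (g : H) (F : tensorHomSubgroup M N) (m : M)
    (h : H) : (g • F).1 (BTensor.tmul R m h) = F.1 (BTensor.tmul R m (h * g)) := by
  change F.1 (idTensorSMul M g _) = _
  simp

/-- The left inner hom-object of left `H`-modules, `Hom_{H-}(M ⊗_R H, N)`. -/
def leftInnerHom (M N : LeftModule R H) : LeftModule R H :=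
  LeftModule.ofModule R H (tensorHomSubgroup M N)

/-- The `H`-linear map `M ⊗_R H → N` underlying an element of the left inner hom-object. -/
def leftInnerHom.toHom {M N : LeftModule R H} : leftInnerHom M N →+ BTensor R M H →+ N :=
  (tensorHomSubgroup M N).subtype

open leftInnerHom (toHom)

theorem leftInnerHom.toHom_injective {M N : LeftModule R H} :
    Function.Injective (toHom (M := M) (N := N)) := Subtype.val_injective

theorem leftInnerHom.isTensorHom {M N : LeftModule R H} (F : leftInnerHom M N) (h : H)
    (x : BTensor R M H) : toHom F (takeuchiAct (comul (R := R) h) x) = h • toHom F x :=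
  Subtype.property (show tensorHomSubgroup M N from F) h x

theorem leftInnerHom.smul_tmul {M N : LeftModule R H} (g : H) (F : leftInnerHom M N) (m : M)
    (h : H) : toHom (g • F) (BTensor.tmul R m h) = toHom F (BTensor.tmul R m (h * g)) :=
  tensorHom_smul_tmul M N g F m h

/-- The evaluation `m ⊗ F ↦ F(m ⊗ 1)`. -/
def leftEval (M N : LeftModule R H) : BTensor R M (leftInnerHom M N) →+ N :=
  BTensor.lift R
    (AddMonoidHom.mk' (fun m => (AddMonoidHom.eval (BTensor.tmul R m (1 : H))).comp toHom)
      (fun m m' => by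
        ext F
        exact (congrArg (toHom F) (BTensor.add_tmul R m m' 1)).trans (map_add _ _ _)))
    (fun r m F => by
      change toHom F (BTensor.tmul R (op r • m) 1) = toHom (r • F) (BTensor.tmul R m 1)
      rw [← one_smul H F, ← smul_assoc, one_smul, leftInnerHom.smul_tmul, BTensor.smul_tmul,
        one_mul])

@[simp] theorem leftEval_tmul (M N : LeftModule R H) (m : M) (F : leftInnerHom M N) :
    leftEval M N (BTensor.tmul R m F) = toHom F (BTensor.tmul R m 1) :=
  BTensor.lift_tmul _ _ m F

/-- A map f on M ⊗ Z corresponds to z ↦ (m ⊗ h ↦ f(m ⊗ h z)). The correspondence is forced because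
F(m ⊗ h) = (h F)(m ⊗ 1), so F is recovered from the evaluations of its `H`-multiples. -/
theorem isLeftInnerHom_leftEval (M N : LeftModule R H) : IsLeftInnerHom (leftEval M N) := by
  refine ⟨fun h x => ?_, fun Z f hf => ?_⟩
  · refine BTensor.hom_congr (f := (leftEval M N).comp (takeuchiAct (comul h)))
      (g := (DistribSMul.toAddMonoidHom N h).comp (leftEval M N)) (fun m F => ?_) x
    change leftEval M N (takeuchiAct _ _) = h • leftEval M N _
    rw [takeuchiAct_tmul, leftEval_tmul, ← leftInnerHom.isTensorHom, takeuchiAct_tmul]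
    refine BTensor.hom_congr (f := (leftEval M N).comp (applyTo R m F))
      (g := (toHom F).comp (applyTo R m 1)) (fun a b => ?_) _
    simp [leftInnerHom.smul_tmul]
  · let g : Z →ₗ[H] leftInnerHom M N :=
      { toFun := fun z => (⟨f.comp (idTensorSMul M z), fun h x => by
          rw [AddMonoidHom.comp_apply, idTensorSMul_takeuchiAct, hf]; rfl⟩ :
          tensorHomSubgroup M N)
        map_add' := fun z z' => Subtype.ext (BTensor.hom_ext fun m h => by
          change f (idTensorSMul M (z + z') _) = f (idTensorSMul M z _) + f (idTensorSMul M z' _)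
          simp [BTensor.tmul_add])
        map_smul' := fun h z => Subtype.ext (BTensor.hom_ext fun m h' => by
          change f (idTensorSMul M (h • z) _) = f (idTensorSMul M z (idTensorSMul M h _))
          simp [mul_smul]) }
    have hg : ∀ z, toHom (g z) = f.comp (idTensorSMul M z) := fun z => rfl
    refine ⟨g, fun z m => ?_, fun g' hg' => LinearMap.ext fun z => leftInnerHom.toHom_injective
      (BTensor.hom_ext fun m h => ?_)⟩
    · simp [hg]
    · rw [hg, AddMonoidHom.comp_apply, idTensorSMul_tmul, ← hg', map_smul, leftEval_tmul,
        leftInnerHom.smul_tmul, one_mul]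

variable {k : Type v} [CommRing k] [Algebra k R] [Algebra k H] [IsScalarTower k R H]
  [IsScalarTower k Rᵐᵒᵖ H]

/-- Hom_R(M, N) with the obvious evaluation is a left inner hom of bimodules. Preservation therefore
identifies it with Hom_H(M ⊗ H, N), by restriction to the elements m ⊗ 1. -/
theorem IsAntiHopf.existsUnique_tensorHom (hH : IsAntiHopf k R H) (M N : LeftModule R H)
    (f : M →ₗ[R] N) :
    ∃! F : tensorHomSubgroup M N, ∀ m, F.1 (BTensor.tmul R m 1) = f m := by
  obtain ⟨hev, huniv⟩ := hH M N _ _ (isLeftInnerHom_leftEval M N)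
  -- The test bimodule is Hom_R(M, N) itself; the universal property turns its evaluation into a map
  -- `g` that extends R-linear maps to `H`-linear ones.
  let Z : Bimodule k R := Bimodule.ofCentral k (HomBimodule M N) (fun c z => DFunLike.ext _ _
    fun m => by
      rw [HomBimodule.smul_apply, HomBimodule.op_smul_apply, op_algebraMap_smul_module (H := H),
        op_algebraMap_smul_module (H := H), map_smul])
  let ev : BTensor R M Z →+ N := BTensor.lift R
    (AddMonoidHom.mk' (fun m => AddMonoidHom.mk' (fun z : HomBimodule M N => z m)
      (fun z z' => HomBimodule.add_apply z z' m)) (fun m m' => by ext z; exact map_add z m m'))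
    (fun r m z => rfl)
  have ev_tmul : ∀ (m : M) (z : Z), ev (BTensor.tmul R m z) = (show HomBimodule M N from z) m :=
    fun m z => BTensor.lift_tmul _ _ m z
  have hevZ : IsBimoduleHom R ev := by
    refine ⟨fun r x => ?_, fun r x => ?_⟩
    · refine BTensor.hom_congr (f := ev.comp (DistribSMul.toAddMonoidHom _ r))
        (g := (DistribSMul.toAddMonoidHom N r).comp ev) (fun m z => ?_) x
      simp only [AddMonoidHom.comp_apply, DistribSMul.toAddMonoidHom_apply, BTensor.smul_tmul',
        ev_tmul]
      exact map_smul (show HomBimodule M N from z) r m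
    · refine BTensor.hom_congr (f := ev.comp (DistribSMul.toAddMonoidHom _ (op r)))
        (g := (DistribSMul.toAddMonoidHom N (op r)).comp ev) (fun m z => ?_) x
      simp only [AddMonoidHom.comp_apply, DistribSMul.toAddMonoidHom_apply, BTensor.op_smul_tmul,
        ev_tmul]
      rfl
  obtain ⟨g, ⟨hg, hge⟩, -⟩ := huniv Z ev hevZ
  let P : Bimodule k R := Bimodule.ofCentral k (leftInnerHom M N)
    (fun c z => op_algebraMap_smul_module (H := H) c z)
  let res : leftInnerHom M N →+ Z := AddMonoidHom.mk' (fun F =>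
      ({ toFun := fun m => toHom F (BTensor.tmul R m 1)
         map_add' := fun m m' => by rw [BTensor.add_tmul, map_add]
         map_smul' := fun r m => by
          rw [RingHom.id_apply, ← BTensor.smul_tmul', ← takeuchiAct_comul_smul_one (H := H),
            leftInnerHom.isTensorHom, smul_assoc, one_smul] } : M →ₗ[R] N)) (fun F G => rfl)
  have hres : IsBimoduleHom R res := by
    refine ⟨fun r F => LinearMap.ext fun m => ?_, fun r F => LinearMap.ext fun m => ?_⟩
    · change toHom (r • F) (BTensor.tmul R m 1) = toHom F (BTensor.tmul R (op r • m) 1)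
      rw [← one_smul H F, ← smul_assoc, one_smul, leftInnerHom.smul_tmul, BTensor.smul_tmul,
        one_mul]
    · change toHom (op r • F) (BTensor.tmul R m 1) = op r • toHom F (BTensor.tmul R m 1)
      rw [← one_smul H F, ← smul_assoc, one_smul, leftInnerHom.smul_tmul, one_mul,
        ← BTensor.op_smul_tmul, ← takeuchiAct_comul_op_smul_one (H := H),
        leftInnerHom.isTensorHom, smul_assoc, one_smul]
  -- Uniqueness of extensions: `g` after restriction and the identity are both bimodule
  -- endomorphisms of the inner hom compatible with evaluation.
  have key : g.comp res = AddMonoidHom.id _ := by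
    refine (huniv P (leftEval M N) hev).unique ⟨⟨fun r a => ?_, fun r a => ?_⟩, fun m z => ?_⟩
      ⟨⟨fun r a => rfl, fun r a => rfl⟩, fun m z => rfl⟩
    · exact (congrArg g (hres.1 r a)).trans (hg.1 r _)
    · exact (congrArg g (hres.2 r a)).trans (hg.2 r _)
    · exact (hge m (res z)).trans ((ev_tmul m (res z)).trans (leftEval_tmul M N m z).symm)
  refine ⟨g f, fun m => ?_, fun F hF => ?_⟩
  · exact (leftEval_tmul M N m (g f)).symm.trans ((hge m f).trans (ev_tmul m f))
  · have : res F = f := LinearMap.ext hF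
    exact (DFunLike.congr_fun key F).symm.trans (congrArg g this)

/-- If `H` is `×_R`-anti-Hopf, then `H ⊗_R H` is generated by the elements `∑ g₁ b ⊗ g₂`. -/
theorem IsAntiHopf.tensor_hom_ext (hH : IsAntiHopf k R H) {X : Type*} [AddCommGroup X]
    {α β : BTensor R H H →+ X}
    (h : ∀ g b : H, α (applyTo R b (1 : H) (comul (R := R) g).1)
      = β (applyTo R b (1 : H) (comul (R := R) g).1)) : α = β := by
  let _ : Module H (BTensor R H H) := diagonalModule R H H H
  have smul_def : ∀ (g : H) (x : BTensor R H H), g • x = takeuchiAct (comul (R := R) g) x :=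
    fun _ _ => rfl
  let C : AddSubgroup (BTensor R H H) := AddSubgroup.closure
    {x | ∃ g b : H, x = applyTo R b (1 : H) (comul (R := R) g).1}
  -- Since g · (b ⊗ 1) = ∑ g₁ b ⊗ g₂, the additive span of these elements is already stable under
  -- `H`.
  let S : Submodule H (BTensor R H H) :=
    { C.toAddSubmonoid with
      smul_mem' := fun g x hx => by
        change g • x ∈ C
        change x ∈ C at hx
        induction hx using AddSubgroup.closure_induction with
        | mem x hx =>
          obtain ⟨g', b, rfl⟩ := hx
          refine AddSubgroup.subset_closure ⟨g * g', b, ?_⟩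
          rw [smul_def, comul_mul, applyTo_takeuchiAct]
        | zero => rw [smul_zero]; exact C.zero_mem
        | add x y _ _ hx hy => rw [smul_add]; exact C.add_mem hx hy
        | neg x _ hx => rw [smul_neg]; exact C.neg_mem hx }
  let N : LeftModule R H := LeftModule.ofModule R H (BTensor R H H ⧸ S)
  let F : tensorHomSubgroup (regularModule R H) N := ⟨S.mkQ.toAddMonoidHom, fun _ _ => rfl⟩
  -- The projection onto the quotient by `S` and the zero map both extend 0, since b ⊗ 1 lies in
  -- `S`; hence the quotient vanishes.
  have hF : F = 0 := (hH.existsUnique_tensorHom (regularModule R H) N 0).unique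
    (fun m => (Submodule.Quotient.mk_eq_zero S).2 (AddSubgroup.subset_closure ⟨1, m, by
      rw [comul_one, applyTo_tmul, one_smul, one_smul]⟩)) (fun m => rfl)
  ext x
  have hx : x ∈ C := (Submodule.Quotient.mk_eq_zero S).1 (DFunLike.congr_fun
    (congrArg Subtype.val hF) x)
  induction hx using AddSubgroup.closure_induction with
  | mem x hx => obtain ⟨g, b, rfl⟩ := hx; exact h g b
  | zero => simp
  | add x y _ _ hx hy => simp [hx, hy]
  | neg x _ hx => simp [hx]

/-- If `H` is `×_R`-anti-Hopf, then every left `R`-linear `p : H → R` gives a map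
`H ⊗_R H → H` with `∑ g₁ b ⊗ g₂ ↦ g p(b)`. -/
theorem IsAntiHopf.exists_antiTranslate (hH : IsAntiHopf k R H) (p : H →ₗ[R] R) :
    ∃ F : BTensor R H H →+ H, ∀ g b : H,
      F (applyTo R b (1 : H) (comul (R := R) g).1) = g * (p b • (1 : H)) := by
  obtain ⟨F, hF, -⟩ := hH.existsUnique_tensorHom (regularModule R H) (regularModule R H)
    ((LinearMap.toSpanSingleton R H 1).comp p)
  refine ⟨F.1, fun g b => ?_⟩
  rw [← takeuchiAct_tmul]
  refine (F.2 g _).trans ?_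
  rw [hF]
  rfl

end LeftInnerHom

/-! ### A criterion for being Hopf by extension of linear maps -/

section HopfCriterion

variable {R H : Type u} [Ring R] [Ring H] [Module R H] [Module Rᵐᵒᵖ H]
  [IsScalarTower R H H] [IsScalarTower Rᵐᵒᵖ H H] [SMulCommClass R Rᵐᵒᵖ H]
  [TakeuchiBialgebra R H]

/-- A `×_R`-bialgebra is `×_R`-Hopf if every `R̄`-linear map `M → N` of left `H`-modules extends
uniquely to an `H`-linear map `H ⊗_R M → N`. -/
theorem isHopf_of_existsUnique_extension (k : Type v) [CommRing k] [Algebra k R]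
    (hext : ∀ (M N : LeftModule R H) (f : M →ₗ[Rᵐᵒᵖ] N), ∃! F : BTensor R H M →+ N,
      IsTensorHom R H (M := regularModule R H) F ∧ ∀ m, F (BTensor.tmul R 1 m) = f m) :
    IsHopf k R H := by
  rintro M N P ev ⟨hev, huniv⟩
  have hbi : IsBimoduleHom R ev := by
    refine ⟨fun r x => ?_, fun r x => ?_⟩
    · rw [← takeuchiAct_comul_smul_one (H := H), hev, smul_assoc, one_smul]
    · rw [← takeuchiAct_comul_op_smul_one (H := H), hev, smul_assoc, one_smul]
  -- An element p of `P` is the `H`-linear map h ↦ h p, hence an `H`-linear map H ⊗ M → N, hence by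
  -- `hext` the R̄-linear map ev(p ⊗ -). So `hunique` shows that p is determined by that map, and
  -- `hex` that every f(z ⊗ -) is of this form.
  have hext_p : ∀ p : P, IsTensorHom R H (M := regularModule R H) (ev.comp (smulTensorId M p)) := by
    intro p h x
    change ev (smulTensorId M p (takeuchiAct (comul h) x)) = h • ev (smulTensorId M p x)
    rw [← hev]
    exact congrArg ev (map_takeuchiAct _ _ (fun g n => by simp [mul_smul]) (fun _ _ => rfl) _ x)
  have hunique : ∀ p q : P, (∀ m, ev (BTensor.tmul R p m) = ev (BTensor.tmul R q m)) → p = q := by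
    intro p q hpq
    let f : M →ₗ[Rᵐᵒᵖ] N :=
      { toFun := fun m => ev (BTensor.tmul R p m)
        map_add' := fun m m' => by rw [BTensor.tmul_add, map_add]
        map_smul' := fun a m => by
          rw [← BTensor.op_smul_tmul]
          exact hbi.2 a.unop _ }
    have e := (hext M N f).unique ⟨hext_p p, fun m => by simp [f]⟩
      ⟨hext_p q, fun m => by simp [f, hpq]⟩
    obtain ⟨g, -, hg⟩ := huniv (regularModule R H) _ (hext_p p)
    have e₁ := hg (LinearMap.toSpanSingleton H P p) (fun z m => by simp)
    have e₂ := hg (LinearMap.toSpanSingleton H P q) (fun z m => by rw [e]; simp)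
    have := DFunLike.congr_fun (e₁.trans e₂.symm) (1 : H)
    simpa using this
  refine ⟨hbi, fun Z f hf => ?_⟩
  have hex : ∀ z : Z, ∃ p : P, ∀ m, ev (BTensor.tmul R p m) = f (BTensor.tmul R z m) := by
    intro z
    let f' : M →ₗ[Rᵐᵒᵖ] N :=
      { toFun := fun m => f (BTensor.tmul R z m)
        map_add' := fun m m' => by rw [BTensor.tmul_add, map_add]
        map_smul' := fun a m => by
          rw [← BTensor.op_smul_tmul]
          exact hf.2 a.unop _ }
    obtain ⟨F, ⟨hF, hF₁⟩, -⟩ := hext M N f'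
    obtain ⟨g, hg, -⟩ := huniv (regularModule R H) F hF
    exact ⟨g (1 : H), fun m => (hg (1 : H) m).trans (hF₁ m)⟩
  choose g hg using hex
  -- The pointwise choice is automatically additive and bilinear, because `hunique` lets every
  -- identity be tested after evaluation.
  refine ⟨AddMonoidHom.mk' g (fun z z' => hunique _ _ fun m => ?_),
    ⟨⟨fun r z => hunique _ _ fun m => ?_, fun r z => hunique _ _ fun m => ?_⟩, hg⟩,
    fun g' hg' => AddMonoidHom.ext fun z => hunique _ _ fun m => ?_⟩
  · rw [hg, BTensor.add_tmul, BTensor.add_tmul, map_add, map_add, hg, hg]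
  · change ev (BTensor.tmul R (g (r • z)) m) = ev (BTensor.tmul R (r • g z) m)
    rw [hg, ← BTensor.smul_tmul', ← BTensor.smul_tmul', hf.1, hbi.1, hg]
  · change ev (BTensor.tmul R (g (op r • z)) m) = ev (BTensor.tmul R (op r • g z) m)
    rw [hg, BTensor.smul_tmul, BTensor.smul_tmul, hg]
  · exact (hg'.2 z m).trans (hg z m).symm

end HopfCriterion

/-! ### Dual bases over R and contraction of the right tensor factor -/

theorem exists_leftDualBasis (R H : Type*) [Ring R] [AddCommGroup H] [Module R H]
    [Module.Finite R H] [Module.Projective R H] :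
    ∃ (n : ℕ) (q : Fin n → H) (p : Fin n → H →ₗ[R] R), ∀ h, ∑ j, p j h • q j = h := by
  obtain ⟨n, π, ι, -, -, h⟩ := Module.Finite.exists_comp_eq_id_of_projective R H
  refine ⟨n, fun j => π (Pi.single j 1), fun j => (LinearMap.proj j).comp ι, fun x => ?_⟩
  have hx : π (ι x) = x := LinearMap.congr_fun h x
  conv_rhs => rw [← hx, ← Finset.univ_sum_single (ι x), map_sum]
  refine Finset.sum_congr rfl fun j _ => ?_
  rw [← map_smul, ← Pi.single_smul, smul_eq_mul, mul_one]
  rfl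

section rightContract

variable {R : Type*} [Ring R] {M N : Type*} [AddCommGroup M] [Module Rᵐᵒᵖ M] [AddCommGroup N]
  [Module R N]

/-- The contraction `M ⊗_R N → M`, `m ⊗ n ↦ m p(n)`. -/
def rightContract (M : Type*) [AddCommGroup M] [Module Rᵐᵒᵖ M] (p : N →ₗ[R] R) :
    BTensor R M N →+ M :=
  BTensor.lift R
    (AddMonoidHom.mk' (fun m => AddMonoidHom.mk' (fun n => op (p n) • m)
        (fun _ _ => by simp [add_smul]))
      (fun _ _ => by ext; simp))
    (fun r m n => by simp [mul_smul])

@[simp] theorem rightContract_tmul (p : N →ₗ[R] R) (m : M) (n : N) :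
    rightContract M p (BTensor.tmul R m n) = op (p n) • m := BTensor.lift_tmul _ _ m n

/-- A dual basis recovers w as the sum of its contractions by pⱼ, tensored with qⱼ. -/
theorem rightContract_ext [Module.Finite R N] [Module.Projective R N] {w w' : BTensor R M N}
    (h : ∀ p : N →ₗ[R] R, rightContract M p w = rightContract M p w') : w = w' := by
  obtain ⟨n, q, p, hq⟩ := exists_leftDualBasis R N
  have : ∀ w : BTensor R M N, ∑ j, BTensor.tmul R (rightContract M (p j) w) (q j) = w := by
    intro w
    have := BTensor.hom_congr
      (f := ∑ j, ((BTensor.tmulHom R M N).flip (q j)).comp (rightContract M (p j)))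
      (g := .id _) (fun m x => ?_) w
    · simpa using this
    · simp only [AddMonoidHom.finsetSum_apply, AddMonoidHom.comp_apply, AddMonoidHom.flip_apply,
        rightContract_tmul, BTensor.tmulHom_apply, BTensor.smul_tmul, AddMonoidHom.id_apply]
      conv_rhs => rw [← hq x]
      exact (map_sum (BTensor.tmulHom R M N m) _ _).symm
  rw [← this w, ← this w']
  simp [h]

end rightContract

/-! ### The maps T_p and the functionals S_p on an anti-Hopf `H` -/

section AntiHopf

variable {R H : Type u} [Ring R] [Ring H] [Module R H] [Module Rᵐᵒᵖ H]
  [IsScalarTower R H H] [IsScalarTower Rᵐᵒᵖ H H] [SMulCommClass R Rᵐᵒᵖ H]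
  [TakeuchiBialgebra R H]

/-- The counit sees its right factor only through the counit of that factor, and ε(r̄) = r. -/
theorem counit_mul_op_smul_one (h : H) (r : R) :
    counit (R := R) (h * (op r • (1 : H))) = counit (R := R) (h * (r • (1 : H))) := by
  rw [counit_mul, counit_op_smul, counit_one, one_mul]

theorem applyTo_one_comul_op_smul (b g : H) (r : R) :
    applyTo R b (1 : H) (comul (R := R) (op r • g)).1
      = op r • applyTo R b (1 : H) (comul (R := R) g).1 := by
  rw [comul_op_smul]
  exact BTensor.hom_congr (f := (applyTo R b (1 : H)).comp (DistribSMul.toAddMonoidHom _ (op r)))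
    (g := (DistribSMul.toAddMonoidHom _ (op r)).comp (applyTo R b (1 : H)))
    (fun a c => by simp) _

theorem comul_mul_smul_one (h : H) (r : R) :
    (comul (R := R) (h * (r • (1 : H)))).1
      = applyTo R (r • (1 : H)) (1 : H) (comul (R := R) h).1 := by
  rw [comul_mul, comul_smul, comul_one, BTensor.smul_tmul', takeuchiAct_tmul]

/-- `∑ ε(h₁ r) h₂ = h r`. -/
theorem counit_left_mul_smul_one (h : H) (r : R)
    (Φ : BTensor R H H →+ H)
    (hΦ : ∀ a c, Φ (BTensor.tmul R a c) = counit (R := R) (a * (r • (1 : H))) • c) :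
    Φ (comul (R := R) h).1 = h * (r • (1 : H)) := by
  obtain ⟨Ψ, hΨ, hΨ'⟩ : ∃ Ψ : BTensor R H H →+ H,
      (∀ a c, Ψ (BTensor.tmul R a c) = counit (R := R) a • c) ∧
        ∀ g : H, Ψ (comul (R := R) g).1 = g :=
    ⟨_, fun a c => BTensor.lift_tmul _ _ a c, counit_left⟩
  refine Eq.trans ?_ (hΨ' _)
  rw [comul_mul_smul_one]
  exact BTensor.hom_congr (f := Φ) (g := Ψ.comp (applyTo R (r • (1 : H)) (1 : H)))
    (fun a c => by simp [hΦ, hΨ]) _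

/-- The map `a ⊗ c ↦ φ(a) c q`. -/
def SkewDual.applySMulMul (φ : SkewDual R H) (q : H) : BTensor R H H →+ H :=
  BTensor.lift R
    (AddMonoidHom.mk' (fun a => (AddMonoidHom.mulRight q).comp (DistribSMul.toAddMonoidHom H (φ a)))
      (fun a b => by ext; simp [add_smul, add_mul]))
    (fun r a b => by simp [mul_smul])

@[simp] theorem SkewDual.applySMulMul_tmul (φ : SkewDual R H) (q a c : H) :
    φ.applySMulMul q (BTensor.tmul R a c) = (φ a • c) * q := BTensor.lift_tmul _ _ a c

/-- The map `w ⊗ c ↦ ε(F(w)) c q` for an `R̄`-linear map `F`. -/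
def counitSMulMul (F : BTensor R H H →+ H)
    (hF : ∀ (r : R) w, F (op r • w) = op r • F w) (q : H) : BTensor R (BTensor R H H) H →+ H :=
  BTensor.lift R
    (AddMonoidHom.mk' (fun w => (AddMonoidHom.mulRight q).comp
        (DistribSMul.toAddMonoidHom H (counit (R := R) (F w))))
      (fun a b => by ext; simp [add_smul, add_mul]))
    (fun r a b => by simp [hF, counit_op_smul, mul_smul])

@[simp] theorem counitSMulMul_tmul (F : BTensor R H H →+ H)
    (hF : ∀ (r : R) w, F (op r • w) = op r • F w) (q : H) (w : BTensor R H H) (c : H) :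
    counitSMulMul F hF q (BTensor.tmul R w c) = (counit (R := R) (F w) • c) * q :=
  BTensor.lift_tmul _ _ w c

theorem smulTensorId_op_smul (b : H) (r : R) (w : BTensor R H H) :
    smulTensorId H b (op r • w) = op r • smulTensorId H b w :=
  BTensor.hom_congr (f := (smulTensorId H b).comp (DistribSMul.toAddMonoidHom _ (op r)))
    (g := (DistribSMul.toAddMonoidHom _ (op r)).comp (smulTensorId H b))
    (fun a c => by simp) w

theorem smulTensorId_eq_applyTo (b : H) (w : BTensor R H H) :
    smulTensorId H b w = applyTo R b (1 : H) w :=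
  BTensor.hom_congr (f := smulTensorId H b) (g := applyTo R b (1 : H)) (fun a c => by simp) w

variable {k : Type v} [CommRing k] [Algebra k R] [Algebra k H] [IsScalarTower k R H]
  [IsScalarTower k Rᵐᵒᵖ H] (hH : IsAntiHopf k R H)

/-- The map `H ⊗_R H → H` with `∑ g₁ b ⊗ g₂ ↦ g p(b)`. -/
noncomputable def IsAntiHopf.antiTranslate (p : H →ₗ[R] R) : BTensor R H H →+ H :=
  (hH.exists_antiTranslate p).choose

namespace IsAntiHopf

theorem antiTranslate_applyTo (p : H →ₗ[R] R) (g b : H) :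
    hH.antiTranslate p (applyTo R b (1 : H) (comul (R := R) g).1) = g * (p b • (1 : H)) :=
  (hH.exists_antiTranslate p).choose_spec g b

/-- On generators this is Δ(r̄ g) = ∑ g₁ ⊗ r̄ g₂. It makes S_p an element of H^∨ and keeps ε ∘ T_p
balanced in `counitSMulMul`. -/
theorem antiTranslate_op_smul (p : H →ₗ[R] R) (r : R) (w : BTensor R H H) :
    hH.antiTranslate p (op r • w) = op r • hH.antiTranslate p w := by
  refine DFunLike.congr_fun (hH.tensor_hom_ext
    (α := (hH.antiTranslate p).comp (DistribSMul.toAddMonoidHom _ (op r)))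
    (β := (DistribSMul.toAddMonoidHom _ (op r)).comp (hH.antiTranslate p)) fun g b => ?_) w
  simp only [AddMonoidHom.comp_apply, DistribSMul.toAddMonoidHom_apply,
    ← applyTo_one_comul_op_smul, antiTranslate_applyTo, smul_mul_assoc]

/-- Since Δ(g r̄) = ∑ g₁ ⊗ g₂ r̄, the operation replaces g by g r̄ in a generator; then r̄ commutes
past p(b) ∈ R. -/
theorem antiTranslate_idTensorSMul (p : H →ₗ[R] R) (r : R) (w : BTensor R H H) :
    hH.antiTranslate p (idTensorSMul H (op r • (1 : H)) w)
      = hH.antiTranslate p w * (op r • (1 : H)) := by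
  refine DFunLike.congr_fun (hH.tensor_hom_ext
    (α := (hH.antiTranslate p).comp (idTensorSMul H (op r • (1 : H))))
    (β := (AddMonoidHom.mulRight (op r • (1 : H))).comp (hH.antiTranslate p)) fun g b => ?_) w
  have h₁ : idTensorSMul H (op r • (1 : H)) (applyTo R b (1 : H) (comul (R := R) g).1)
      = applyTo R b (1 : H) (comul (R := R) (g * (op r • (1 : H)))).1 := by
    rw [SkewDual.comul_mul_op]
    exact BTensor.hom_congr (f := (idTensorSMul H (op r • (1 : H))).comp (applyTo R b (1 : H)))
      (g := (applyTo R b (1 : H)).comp (applyTo R (1 : H) (op r • (1 : H))))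
      (fun a c => by simp) _
  simp only [AddMonoidHom.comp_apply, AddMonoidHom.mulRight_apply]
  rw [h₁, antiTranslate_applyTo, antiTranslate_applyTo, mul_assoc, mul_assoc, smul_mul_assoc,
    smul_mul_assoc, one_mul, one_mul,
    smul_comm (p b) (op r) (1 : H)]

variable {n : ℕ} {q : Fin n → H} {p : Fin n → H →ₗ[R] R}

/-- On a generator ∑ g₁ b ⊗ g₂ both sides equal g p'(b y): expand b in the dual basis on the left,
and replace b by b y on the right. -/
theorem sum_antiTranslate_mul (hq : ∀ h, ∑ j, p j h • q j = h) (p' : H →ₗ[R] R) (y : H)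
    (w : BTensor R H H) :
    ∑ j, hH.antiTranslate (p j) w * (p' (q j * y) • (1 : H))
      = hH.antiTranslate p' (smulTensorId H y w) := by
  have := DFunLike.congr_fun (hH.tensor_hom_ext
    (α := ∑ j, (AddMonoidHom.mulRight (p' (q j * y) • (1 : H))).comp (hH.antiTranslate (p j)))
    (β := (hH.antiTranslate p').comp (smulTensorId H y)) fun g b => ?_) w
  · simpa using this
  · have h₁ : smulTensorId H y (applyTo R b (1 : H) (comul (R := R) g).1)
        = applyTo R (b * y) (1 : H) (comul (R := R) g).1 :=
      BTensor.hom_congr (f := (smulTensorId H y).comp (applyTo R b (1 : H)))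
        (g := applyTo R (b * y) (1 : H)) (fun a c => by simp [mul_assoc]) _
    have h₂ : p' (b * y) = ∑ j, p j b * p' (q j * y) := by
      conv_lhs => rw [← hq b, Finset.sum_mul, map_sum]
      simp [smul_mul_assoc]
    simp only [AddMonoidHom.finsetSum_apply, AddMonoidHom.comp_apply,
      AddMonoidHom.mulRight_apply, antiTranslate_applyTo, h₁, h₂, Finset.sum_smul, Finset.mul_sum]
    refine Finset.sum_congr rfl fun j _ => ?_
    rw [mul_assoc, smul_mul_assoc, one_mul, mul_smul]

/-- The element `h ↦ ε(∑ h₊ p(h₋))` of the skew dual, where `∑ h₊₁ h₋ ⊗ h₊₂ = 1 ⊗ h`. -/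
noncomputable def antipodal (p : H →ₗ[R] R) : SkewDual R H :=
  SkewDual.mk (((counit (R := R)).comp (hH.antiTranslate p)).comp (BTensor.tmulHom R H H 1))
    (fun r h => by
      simp only [AddMonoidHom.comp_apply, BTensor.tmulHom_apply]
      rw [← BTensor.op_smul_tmul (op r), antiTranslate_op_smul, counit_op_smul])

theorem antipodal_apply (p : H →ₗ[R] R) (h : H) :
    hH.antipodal p h = counit (R := R) (hH.antiTranslate p (BTensor.tmul R 1 h)) := rfl

/-- This collapses the sum over the dual basis into a single T_p'. The scalar c crosses the tensor
sign, the factor r̄ with r = p'(qⱼ y) leaves T as a right factor, and under ε it may be replaced by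
r, so `sum_antiTranslate_mul` applies. -/
theorem sum_antipodal_apply (hq : ∀ h, ∑ j, p j h • q j = h) (p' : H →ₗ[R] R) (c : R) (h y : H) :
    ∑ j, hH.antipodal (p j) ((c • h) * (op (p' (q j * y)) • (1 : H)))
      = counit (R := R) (hH.antiTranslate p' (BTensor.tmul R (op c • y) h)) := by
  have e : ∀ r : R, BTensor.tmul R (1 : H) ((c • h) * (op r • (1 : H)))
      = idTensorSMul H (op r • (1 : H)) (BTensor.tmul R (op c • (1 : H)) h) := fun r => by
    rw [idTensorSMul_tmul, smul_eq_mul, smul_mul_assoc, BTensor.smul_tmul]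
  simp only [antipodal_apply, e, antiTranslate_idTensorSMul, counit_mul_op_smul_one]
  rw [← map_sum, hH.sum_antiTranslate_mul hq, smulTensorId_tmul, smul_assoc, smul_eq_mul,
    one_mul]

/-- An antipode identity, ∑ Sⱼ(g₁) g₂ qⱼ = ε(g)‾. The maps b ⊗ g ↦ ∑ ε(Tⱼ(b ⊗ g₁)) g₂ qⱼ and b ⊗ g ↦
ε(g)‾ b both send the generator ∑ g₁ b ⊗ g₂ to g b, so they agree; evaluate at 1 ⊗ g. -/
theorem sum_applySMulMul_comul (hq : ∀ h, ∑ j, p j h • q j = h) (g : H) :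
    ∑ j, (hH.antipodal (p j)).applySMulMul (q j) (comul (R := R) g).1
      = op (counit (R := R) g) • (1 : H) := by
  let Δ : H →ₗ[R] BTensor R H H :=
    { toFun := fun a => (comul (R := R) a).1
      map_add' := fun a b => by simp
      map_smul' := fun r a => comul_smul r a }
  let Δ' : H →ₗ[Rᵐᵒᵖ] BTensor R H H :=
    { toFun := fun a => (comul (R := R) a).1
      map_add' := fun a b => by simp
      map_smul' := fun r a => comul_op_smul r.unop a }
  have hΔ' : ∀ a, Δ' a = (comul (R := R) a).1 := fun _ => rfl
  have coassoc' : ∀ g : H, BTensor.assocInv H H H (BTensor.map LinearMap.id Δ (comul (R := R) g).1)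
      = BTensor.map Δ' LinearMap.id (comul (R := R) g).1 := fun g => (coassoc g).symm
  -- `Λ j b` sends x ⊗ y ⊗ c to ε(Tⱼ(x b ⊗ y)) c qⱼ. The parameter b absorbs right multiplication on
  -- the first leg, so that coassociativity can be applied to g alone.
  let Λ : Fin n → H → BTensor R (BTensor R H H) H →+ H := fun j b =>
    counitSMulMul ((hH.antiTranslate (p j)).comp (smulTensorId H b))
      (fun r w => by simp [smulTensorId_op_smul, antiTranslate_op_smul]) (q j)
  let X : BTensor R H H →+ H :=
    ∑ j, ((Λ j 1).comp (BTensor.assocInv H H H)).comp (BTensor.map LinearMap.id Δ)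
  let Y : BTensor R H H →+ H := BTensor.lift R
    ((AddMonoidHom.mk' (fun c : R => DistribSMul.toAddMonoidHom H (op c))
        (fun a b => by ext; simp [add_smul])).comp counit).flip
      (fun r a b => by simp [counit_smul, mul_smul])
  have hY : ∀ b g, Y (BTensor.tmul R b g) = op (counit (R := R) g) • b :=
    fun b g => BTensor.lift_tmul _ _ b g
  have hXY : X = Y := by
    refine hH.tensor_hom_ext fun g b => ?_
    have hYb : Y (applyTo R b (1 : H) (comul (R := R) g).1) = g * b := by
      conv_rhs => rw [← counit_right (R := R) g]
      refine BTensor.hom_congr (f := Y.comp (applyTo R b (1 : H)))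
        (g := (AddMonoidHom.mulRight b).comp (BTensor.lift R _ _)) (fun a c => ?_) _
      simp [hY, smul_mul_assoc]
    have hXb : ∀ j, Λ j 1 (BTensor.assocInv H H H (BTensor.map LinearMap.id Δ
        (applyTo R b (1 : H) (comul (R := R) g).1))) = g * (p j b • q j) := by
      intro j
      have h₁ : Λ j 1 (BTensor.assocInv H H H (BTensor.map LinearMap.id Δ
          (applyTo R b (1 : H) (comul (R := R) g).1)))
          = Λ j b (BTensor.assocInv H H H (BTensor.map LinearMap.id Δ (comul (R := R) g).1)) := by
        refine BTensor.hom_congr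
          (f := (((Λ j 1).comp (BTensor.assocInv H H H)).comp (BTensor.map LinearMap.id Δ)).comp
            (applyTo R b (1 : H)))
          (g := ((Λ j b).comp (BTensor.assocInv H H H)).comp (BTensor.map LinearMap.id Δ))
          (fun a c => ?_) _
        simp only [AddMonoidHom.comp_apply, applyTo_tmul, BTensor.map_tmul, BTensor.assocInv_tmul,
          LinearMap.id_apply, smul_eq_mul, mul_one]
        refine BTensor.hom_congr (f := (Λ j 1).comp (BTensor.assocAux H (a * b)))
          (g := (Λ j b).comp (BTensor.assocAux H a)) (fun x y => ?_) _
        simp [Λ]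
      let Φ : BTensor R H H →+ H := BTensor.lift R
        (AddMonoidHom.mk' (fun a => DistribSMul.toAddMonoidHom H
          (counit (R := R) (a * (p j b • (1 : H))))) (fun a b => by ext; simp [add_mul, add_smul]))
        (fun r a b => by simp [smul_mul_assoc, counit_op_smul, mul_smul])
      have hΦ : ∀ a c, Φ (BTensor.tmul R a c) = counit (R := R) (a * (p j b • (1 : H))) • c :=
        fun a c => BTensor.lift_tmul _ _ a c
      -- After coassociativity Tⱼ meets Δ(g₁)(b ⊗ 1), a generator, and returns g₁ pⱼ(b).
      have h₂ : Λ j b (BTensor.map Δ' LinearMap.id (comul (R := R) g).1)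
          = Φ (comul (R := R) g).1 * q j := by
        refine BTensor.hom_congr (f := (Λ j b).comp (BTensor.map Δ' LinearMap.id))
          (g := (AddMonoidHom.mulRight (q j)).comp Φ) (fun a c => ?_) _
        simp [Λ, hΦ, hΔ', smulTensorId_eq_applyTo, antiTranslate_applyTo]
      rw [h₁, coassoc', h₂, counit_left_mul_smul_one g (p j b) Φ hΦ, mul_assoc, smul_mul_assoc,
        one_mul]
    rw [hYb]
    simp only [X, AddMonoidHom.finsetSum_apply, AddMonoidHom.comp_apply, hXb]
    rw [← Finset.mul_sum, hq]
  have := DFunLike.congr_fun hXY (BTensor.tmul R 1 g)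
  rw [hY] at this
  rw [← this]
  simp only [X, AddMonoidHom.finsetSum_apply, AddMonoidHom.comp_apply, BTensor.map_tmul,
    BTensor.assocInv_tmul, LinearMap.id_apply]
  refine Finset.sum_congr rfl fun j _ => ?_
  refine BTensor.hom_congr (f := (hH.antipodal (p j)).applySMulMul (q j))
    (g := (Λ j 1).comp (BTensor.assocAux H 1)) (fun a c => ?_) _
  simp [Λ, antipodal_apply]

end IsAntiHopf

end AntiHopf

/-! ### The skew dual: inverting the canonical element and extending linear maps -/

section SkewDualHopf

variable {R H : Type u} [Ring R] [Ring H] [Module R H] [Module Rᵐᵒᵖ H]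
  [IsScalarTower R H H] [IsScalarTower Rᵐᵒᵖ H H] [SMulCommClass R Rᵐᵒᵖ H]
  [TakeuchiBialgebra R H]

namespace SkewDual

theorem sum_apply {ι : Type*} (s : Finset ι) (φ : ι → SkewDual R H) (h : H) :
    (∑ i ∈ s, φ i) h = ∑ i ∈ s, φ i h :=
  map_sum ((evalHom R H).flip h) _ _

theorem op_smul_translate (r : R) (h : H) (φ : SkewDual R H) :
    op r • translate h φ = translate (op r • h) φ := by
  ext x
  simp [mul_assoc]

theorem translate_op_smul (r : R) (h : H) (φ : SkewDual R H) :
    translate h (op r • φ) = translate (h * (op r • (1 : H))) φ := by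
  ext x
  simp [mul_assoc]

theorem translate_one (φ : SkewDual R H) : translate 1 φ = φ := by
  ext x
  simp

variable [Module.Finite Rᵐᵒᵖ H] [Module.Projective Rᵐᵒᵖ H]

/-- By the Takeuchi condition on Δ(x), right multiplication by r̄ in H^∨ sends φ to x ↦ φ(x r). This
is what makes `twist` balanced. -/
theorem translate_smul (r : R) (h : H) (φ : SkewDual R H) :
    translate (r • h) φ = translate h φ * (op r • (1 : SkewDual R H)) := by
  ext x
  rw [mul_op_smul_one_apply, translate_apply, translate_apply, mul_assoc, smul_mul_assoc,
    _root_.one_mul]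

/-- The map `ψ ⊗ h ↦ φ(- h) f(ψ m)`. -/
def twist {M N : Type*} [AddCommGroup M] [Module (SkewDual R H) M] [Module Rᵐᵒᵖ M]
    [IsScalarTower Rᵐᵒᵖ (SkewDual R H) M] [AddCommGroup N] [Module (SkewDual R H) N]
    [Module Rᵐᵒᵖ N] [IsScalarTower Rᵐᵒᵖ (SkewDual R H) N] (f : M →ₗ[Rᵐᵒᵖ] N)
    (φ : SkewDual R H) (m : M) : BTensor R (SkewDual R H) H →+ N :=
  BTensor.lift R
    (AddMonoidHom.mk' (fun ψ => AddMonoidHom.mk' (fun h => translate h φ • f (ψ • m))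
        (fun h h' => by
          rw [← add_smul]
          congr 1
          ext x
          simp [mul_add]))
      (fun ψ ψ' => by ext h; simp [add_smul]))
    (fun r ψ h => by
      simp only [AddMonoidHom.mk'_apply]
      rw [smul_assoc, map_smul, translate_smul, mul_smul, smul_assoc, one_smul])

section

variable {M N : Type*} [AddCommGroup M] [Module (SkewDual R H) M] [Module Rᵐᵒᵖ M]
    [IsScalarTower Rᵐᵒᵖ (SkewDual R H) M] [AddCommGroup N] [Module (SkewDual R H) N]
    [Module Rᵐᵒᵖ N] [IsScalarTower Rᵐᵒᵖ (SkewDual R H) N] (f : M →ₗ[Rᵐᵒᵖ] N)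

@[simp] theorem twist_tmul (φ : SkewDual R H) (m : M) (ψ : SkewDual R H) (h : H) :
    twist f φ m (BTensor.tmul R ψ h) = translate h φ • f (ψ • m) :=
  BTensor.lift_tmul _ _ ψ h

theorem twist_add_left (φ φ' : SkewDual R H) (m : M) :
    twist f (φ + φ') m = twist f φ m + twist f φ' m :=
  BTensor.hom_ext (fun ψ h => by simp [add_smul])

theorem twist_add_right (φ : SkewDual R H) (m m' : M) :
    twist f φ (m + m') = twist f φ m + twist f φ m' :=
  BTensor.hom_ext (fun ψ h => by simp [smul_add])

end

theorem comul_eq_sum {n : ℕ} {e : Fin n → H} {f : Fin n → SkewDual R H}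
    (he : ∀ h, ∑ i, op (f i h) • e i = h) (φ : SkewDual R H) :
    (comul (R := R) φ).1 = ∑ i, BTensor.tmul R (translate (e i) φ) (f i) := by
  change comulAux R H φ = _
  rw [← sum_contract he (comulAux R H φ)]
  simp only [contract_comulAux]

end SkewDual

open SkewDual

variable {k : Type v} [CommRing k] [Algebra k R] [Algebra k H] [IsScalarTower k R H]
  [IsScalarTower k Rᵐᵒᵖ H] [Module.Finite Rᵐᵒᵖ H] [Module.Projective Rᵐᵒᵖ H]
  (hH : IsAntiHopf k R H)

namespace IsAntiHopf

variable {n₁ n₂ : ℕ} {e : Fin n₁ → H} {f : Fin n₁ → SkewDual R H} {q : Fin n₂ → H}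
  {p : Fin n₂ → H →ₗ[R] R}

/-- Contract the right factor with g. Since (eⁱ Sⱼ)(g) = ∑ eⁱ(Sⱼ(g₁) g₂), the dual basis property in
i leaves ∑ Sⱼ(g₁) g₂ qⱼ, which is ε(g)‾. -/
theorem sum_mul_tmul_mul (he : ∀ h, ∑ i, op (f i h) • e i = h) (hq : ∀ h, ∑ j, p j h • q j = h) :
    ∑ j, ∑ i, BTensor.tmul R (e i * q j) (f i * hH.antipodal (p j))
      = BTensor.tmul R (1 : H) (1 : SkewDual R H) := by
  refine contract_ext fun g => ?_
  have h₁ : ∀ j, ∑ i, op ((f i * hH.antipodal (p j)) g) • (e i * q j)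
      = (hH.antipodal (p j)).applySMulMul (q j) (comul (R := R) g).1 := by
    intro j
    have h₂ : ∀ i, op ((f i * hH.antipodal (p j)) g) • (e i * q j)
        = (((AddMonoidHom.mk' (fun r : R => op r • (e i * q j))
          (fun a b => by simp [add_smul])).comp (conv (f i) (hH.antipodal (p j)))))
            (comul (R := R) g).1 := fun i => rfl
    simp only [h₂]
    rw [← AddMonoidHom.finsetSum_apply]
    refine BTensor.hom_congr (fun a c => ?_) _
    simp only [AddMonoidHom.finsetSum_apply, AddMonoidHom.comp_apply, AddMonoidHom.mk'_apply,
      conv_tmul, applySMulMul_tmul, ← smul_mul_assoc]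
    rw [← Finset.sum_mul, he]
  simp only [map_sum, contract_tmul, h₁]
  rw [hH.sum_applySMulMul_comul hq, one_apply]

variable [Module.Finite R H] [Module.Projective R H]

/-- Contract with p' and evaluate at g. Summing over j by `sum_antipodal_apply` and over i by the
dual basis gives ε(T_p'(∑ g₁ ⊗ g₂)), and ∑ g₁ ⊗ g₂ is the generator with b = 1; the value is ε(g
p'(1)). -/
theorem sum_antipodal_mul_tmul (he : ∀ h, ∑ i, op (f i h) • e i = h)
    (hq : ∀ h, ∑ j, p j h • q j = h) :
    ∑ i, ∑ j, BTensor.tmul R (hH.antipodal (p j) * f i) (q j * e i)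
      = BTensor.tmul R (1 : SkewDual R H) (1 : H) := by
  refine rightContract_ext fun p' => ?_
  simp only [map_sum, rightContract_tmul]
  ext g
  simp only [SkewDual.sum_apply]
  have h₁ : ∀ i j, (op (p' (q j * e i)) • (hH.antipodal (p j) * f i)) g
      = conv (op (p' (q j * e i)) • hH.antipodal (p j)) (f i) (comul (R := R) g).1 := by
    intro i j
    rw [← smul_mul_assoc, mul_apply]
  have h₂ : ∑ i, ∑ j, conv (op (p' (q j * e i)) • hH.antipodal (p j)) (f i) (comul (R := R) g).1
      = counit (R := R) (hH.antiTranslate p' (applyTo R (1 : H) (1 : H) (comul (R := R) g).1)) := by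
    simp only [← AddMonoidHom.finsetSum_apply]
    refine BTensor.hom_congr (g := ((counit (R := R)).comp (hH.antiTranslate p')).comp
      (applyTo R (1 : H) (1 : H))) (fun a c => ?_) _
    simp only [AddMonoidHom.finsetSum_apply, AddMonoidHom.comp_apply, conv_tmul, applyTo_tmul,
      op_smul_apply, hH.sum_antipodal_apply hq, smul_eq_mul, _root_.mul_one]
    conv_rhs => rw [← he a]
    have := fun x : H => (BTensor.tmulHom_apply (R := R) x c).symm
    simp only [this, map_sum, AddMonoidHom.finsetSum_apply]
  simp only [h₁]
  rw [h₂, antiTranslate_applyTo, op_smul_apply, one_apply, counit_mul_op_smul_one]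

/-- Contracted with p' and evaluated at g, both sides are ε(T_p'(r̄ ⊗ g)): take c = 1, y = r̄ on one
side and c = r, y = 1 on the other in `sum_antipodal_apply`. -/
theorem sum_antipodal_tmul_mul_op_smul (hq : ∀ h, ∑ j, p j h • q j = h) (r : R) :
    ∑ j, BTensor.tmul R (hH.antipodal (p j)) (q j * (op r • (1 : H)))
      = ∑ j, BTensor.tmul R (hH.antipodal (p j) * (r • (1 : SkewDual R H))) (q j) := by
  refine rightContract_ext fun p' => ?_
  simp only [map_sum, rightContract_tmul]
  ext g
  simp only [SkewDual.sum_apply, op_smul_apply, mul_smul_one_apply]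
  have h₁ := hH.sum_antipodal_apply hq p' 1 g (op r • (1 : H))
  have h₂ := hH.sum_antipodal_apply hq p' r g 1
  simp only [one_smul, op_one, _root_.mul_one] at h₁ h₂
  rw [h₁, ← h₂]
  simp only [smul_mul_assoc]

/-- If `H` is `×_R`-anti-Hopf, left finite and right finite, then its left skew dual is
`×_R`-Hopf. -/
theorem isHopf_skewDual (hH : IsAntiHopf k R H) : IsHopf k R (SkewDual R H) := by
  obtain ⟨n₁, e, f, he⟩ := exists_dualBasis R H
  obtain ⟨n₂, q, p, hq⟩ := exists_leftDualBasis R H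
  refine isHopf_of_existsUnique_extension k fun M N l => ?_
  let W : BTensor R (SkewDual R H) H := ∑ j, BTensor.tmul R (hH.antipodal (p j)) (q j)
  -- Explicitly F(φ ⊗ m) = ∑ φ(- qⱼ) l(Sⱼ m). Balancedness over R is the identity moving r̄ past qⱼ
  -- to the right of Sⱼ.
  let F : BTensor R (SkewDual R H) M →+ N := BTensor.lift R
    (AddMonoidHom.mk' (fun φ => AddMonoidHom.mk' (fun m => twist l φ m W)
        (fun m m' => by rw [twist_add_right]; rfl))
      (fun φ φ' => by ext m; simp [twist_add_left]))
    (fun r φ m => by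
      have h := congrArg (twist l φ m) (hH.sum_antipodal_tmul_mul_op_smul hq r)
      simp only [map_sum, twist_tmul, mul_smul, smul_assoc, one_smul] at h
      simp only [AddMonoidHom.mk'_apply, W, map_sum, twist_tmul, SkewDual.translate_op_smul]
      exact h)
  have hF : ∀ φ m, F (BTensor.tmul R φ m) = twist l φ m W := fun φ m => BTensor.lift_tmul _ _ φ m
  -- Here φ · (1 ⊗ m) = ∑ φ(- eᵢ) ⊗ eⁱ m, so F produces φ(- qⱼ eᵢ) l(Sⱼ eⁱ m), and
  -- `sum_antipodal_mul_tmul` collapses the double sum.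
  have hF_act : ∀ (φ : SkewDual R H) (m : M),
      F (takeuchiAct (comul (R := R) φ) (BTensor.tmul R 1 m)) = φ • l m := by
    intro φ m
    have h := congrArg (twist l φ m) (hH.sum_antipodal_mul_tmul he hq)
    simp only [map_sum, twist_tmul, SkewDual.translate_one, one_smul] at h
    rw [takeuchiAct_tmul, comul_eq_sum he, ← h]
    simp only [map_sum, applyTo_tmul, smul_eq_mul, _root_.mul_one, hF, W, twist_tmul,
      SkewDual.translate_translate, mul_smul]
  have hspan : ∀ (φ : SkewDual R H) (m : M), BTensor.tmul R φ m = ∑ j,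
      takeuchiAct (comul (R := R) (SkewDual.translate (q j) φ))
        (BTensor.tmul R 1 (hH.antipodal (p j) • m)) := by
    intro φ m
    -- `U` transports the identity `sum_mul_tmul_mul` from H ⊗ H^∨ into H^∨ ⊗ M.
    let U : BTensor R H (SkewDual R H) →+ BTensor R (SkewDual R H) M := BTensor.lift R
      (AddMonoidHom.mk' (fun h => AddMonoidHom.mk'
          (fun ψ => BTensor.tmul R (SkewDual.translate h φ) (ψ • m))
          (fun ψ ψ' => by rw [add_smul, BTensor.tmul_add]))
        (fun h h' => by
          ext ψ
          have : SkewDual.translate (h + h') φ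
              = SkewDual.translate h φ + SkewDual.translate h' φ := by
            ext x; simp [mul_add]
          simp [this, BTensor.add_tmul]))
      (fun r h ψ => by simp [← op_smul_translate, BTensor.smul_tmul])
    have hU : ∀ h ψ, U (BTensor.tmul R h ψ) = BTensor.tmul R (SkewDual.translate h φ) (ψ • m) :=
      fun h ψ => BTensor.lift_tmul _ _ h ψ
    have h := congrArg U (hH.sum_mul_tmul_mul he hq)
    simp only [map_sum, hU, SkewDual.translate_one, one_smul] at h
    rw [← h]
    refine Finset.sum_congr rfl fun j _ => ?_
    rw [takeuchiAct_tmul, comul_eq_sum he]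
    simp only [map_sum, applyTo_tmul, smul_eq_mul, _root_.mul_one, SkewDual.translate_translate,
      mul_smul]
  refine ⟨F, ⟨fun χ x => ?_, fun m => ?_⟩, fun F' hF' => BTensor.hom_ext fun φ m => ?_⟩
  · refine BTensor.hom_congr (f := F.comp (takeuchiAct (comul (R := R) χ)))
      (g := (DistribSMul.toAddMonoidHom N χ).comp F) (fun φ m => ?_) x
    -- On the spanning elements φ' · (1 ⊗ m'), linearity of F reduces to associativity of the
    -- action, because F(φ' · (1 ⊗ m')) = φ' l(m').
    rw [hspan]
    simp only [map_sum, AddMonoidHom.comp_apply, DistribSMul.toAddMonoidHom_apply, hF_act,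
      ← takeuchiAct_comul_mul, mul_smul]
  · have := hF_act 1 m
    rwa [takeuchiAct_comul_one, one_smul] at this
  · have hF'_act : ∀ (φ : SkewDual R H) (m : M),
        F' (takeuchiAct (comul (R := R) φ) (BTensor.tmul R 1 m)) = φ • l m :=
      fun φ m => by rw [← hF'.2]; exact hF'.1 φ _
    rw [hspan]
    simp only [map_sum, hF_act, hF'_act]

end IsAntiHopf

end SkewDualHopf

end Takeuchi

theorem mainTheorem2 {k : Type v} {R H : Type u} [CommRing k] [Ring R] [Algebra k R]
    [Ring H] [Algebra k H] [Module R H] [Module Rᵐᵒᵖ H]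
    [IsScalarTower R H H] [IsScalarTower Rᵐᵒᵖ H H] [SMulCommClass R Rᵐᵒᵖ H]
    [IsScalarTower k R H] [IsScalarTower k Rᵐᵒᵖ H] [Takeuchi.TakeuchiBialgebra R H]
    [Module.Finite Rᵐᵒᵖ H] [Module.Projective Rᵐᵒᵖ H]
    [Module.Finite R H] [Module.Projective R H]
    (hHopf : Takeuchi.IsHopf k R H) (hAnti : Takeuchi.IsAntiHopf k R H) :
    Takeuchi.IsHopf k R (Takeuchi.SkewDual R H) :=
  hAnti.isHopf_skewDual
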